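/- For a $C^1$ vector field $v=(v_1,v_2,v_3)$ on $\mathbb{R}^3$ write $Dv=[\partial_i v_j]_{i,j}$ and $Dv^{\pm}=\tfrac12\big(Dv\pm (Dv)^{T}\big)$. Let $s>\tfrac52$ and $T>0$, and let $u\in C([0,T];H^s(\mathbb{R}^3))\cap C^1([0,T];H^{s-1}(\mathbb{R}^3))$, with pressure $p$, be a solution on $[0,T]$ of the incompressible Euler equations $$\partial_t u+(u\cdot\nabla)u+\nabla p=0,\qquad \nabla\cdot u=0,\qquad u(\cdot,0)=u_0$$ ($u(t)$ and $\partial_t u(t)$ are identified with their continuous representatives, and $p(t)$ is $C^1$ in space). Let $\omega=\nabla\wedge u$. For $L>0$ and $\delta>0$ put $$\|\omega(t)\|_{C^\delta}=\sup_{0<|x-y|<L}\frac{|\omega(x,t)-\omega(y,t)|}{|x-y|^\delta}\in[0,\infty],\qquad \ell_\delta(t)=\min\Big\{L,\Big(\frac{\|\omega(t)\|_{C^\delta}}{\|u_0\|_{L^2}}\Big)^{-\frac{2}{2\delta+5}}\Big\},$$ with $\ell_\delta(t)=L$ if $\|\omega(t)\|_{C^\delta}=0$; and if $\|\omega(t)\|_{C^\delta}=\infty$,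 then $\ell_\delta(t)=0$ and $\ell_\delta(t)^{-5/2}=\infty$. Then for every $\delta>0$ there is a finite constant $C_\delta>0$, depending only on $\delta$ (not on $u$, $p$, $u_0$, $t$, $T$, $s$ or $L$), such that $$\|Du^+(t)\|_{L^\infty}+\|Du^-(t)\|_{L^\infty}\le C_\delta\,\|u_0\|_{L^2}\,\ell_\delta(t)^{-\frac52}\qquad\text{for all } t\in[0,T],$$ and $C_\delta=O(1/\delta)$: there is an absolute constant $A$ with $C_\delta\le A/\delta$ for all $\delta>0$. (The $L^\infty$ norm of a matrix field is taken with respect to the Frobenius norm.) -/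

import Mathlib

open MeasureTheory Filter Set
open scoped ENNReal Topology FourierTransform

namespace EulerFlow

noncomputable section

/-- Physical space `ℝ³`, with the Euclidean norm. -/
abbrev Space : Type := EuclideanSpace ℝ (Fin 3)

/-- `ℂ³`, with the Hermitian norm. -/
abbrev CSpace : Type := EuclideanSpace ℂ (Fin 3)

/-- The `i`-th standard unit vector of `ℝ³`. -/
def basisVec (i : Fin 3) : Space := EuclideanSpace.single i (1 : ℝ)

/-- A real vector field, regarded as a complex one. -/
def complexify (f : Space → Space) (x : Space) : CSpace :=
  WithLp.toLp 2 fun i => ((f x i : ℝ) : ℂ)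

open Classical in
/-- The inhomogeneous Sobolev norm `‖f‖_{H^s} = ‖(1 + |ξ|²)^{s/2} f̂‖_{L²}` of a vector field that
belongs to `L²` (only orders `s ≥ 0` are used), where `f̂` is the Fourier transform on `L²`;
the value is `∞` when `f` is not in `L²` or not in `H^s`. -/
def sobolevNorm (s : ℝ) (f : Space → Space) : ℝ≥0∞ :=
  if h : MemLp (complexify f) 2 volume then
    eLpNorm (fun ξ : Space =>
      ((1 + ‖ξ‖ ^ 2) ^ (s / 2) : ℝ) • (𝓕 (h.toLp (complexify f)) : Lp CSpace 2 volume) ξ) 2 volume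
  else ∞

/-- `w ∈ C([0,T]; H^s)`. -/
def ContinuousInSobolev (s T : ℝ) (w : ℝ → Space → Space) : Prop :=
  ∀ t ∈ Icc 0 T, sobolevNorm s (w t) < ∞ ∧
    Tendsto (fun τ => sobolevNorm s (w τ - w t)) (𝓝[Icc 0 T] t) (𝓝 0)

/-- On `[0,T]` the path `w` is differentiable in `H^s`, with derivative `w'`
(one-sided at the endpoints). -/
def HasDerivInSobolev (s T : ℝ) (w w' : ℝ → Space → Space) : Prop :=
  ∀ t ∈ Icc 0 T,
    Tendsto (fun τ => sobolevNorm s ((τ - t)⁻¹ • (w τ - w t) - w' t))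
      (𝓝[Icc 0 T \ {t}] t) (𝓝 0)

/-- The pointwise time derivative `∂ₜ u(x,t)` on the interval `[0,T]`. -/
def timeDeriv (T : ℝ) (u : ℝ → Space → Space) (t : ℝ) (x : Space) : Space :=
  derivWithin (fun τ => u τ x) (Icc 0 T) t

/-- The velocity gradient `Du = [∂ᵢ uⱼ]ᵢⱼ`. -/
def velGrad (v : Space → Space) (x : Space) : Matrix (Fin 3) (Fin 3) ℝ :=
  Matrix.of fun i j => fderiv ℝ v x (basisVec i) j

/-- The divergence `∇ · v`. -/
def divergence (v : Space → Space) (x : Space) : ℝ := ∑ i, velGrad v x i i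

/-- The vorticity `∇ ∧ v`. -/
def curl (v : Space → Space) (x : Space) : Space :=
  !₂[velGrad v x 1 2 - velGrad v x 2 1,
     velGrad v x 2 0 - velGrad v x 0 2,
     velGrad v x 0 1 - velGrad v x 1 0]

/-- The symmetric part `Du⁺ = (Du + Duᵀ) / 2` (the deformation tensor). -/
def symGrad (v : Space → Space) (x : Space) : Matrix (Fin 3) (Fin 3) ℝ :=
  (1 / 2 : ℝ) • (velGrad v x + (velGrad v x).transpose)

/-- The antisymmetric part `Du⁻ = (Du - Duᵀ) / 2`. -/
def antiGrad (v : Space → Space) (x : Space) : Matrix (Fin 3) (Fin 3) ℝ :=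
  (1 / 2 : ℝ) • (velGrad v x - (velGrad v x).transpose)

/-- The Euclidean (Frobenius) norm of a matrix. -/
def matrixNorm (M : Matrix (Fin 3) (Fin 3) ℝ) : ℝ := Real.sqrt (∑ i, ∑ j, M i j ^ 2)

/-- The `L^∞` norm of a matrix-valued function on `ℝ³`. -/
def linftyNorm (M : Space → Matrix (Fin 3) (Fin 3) ℝ) : ℝ≥0∞ :=
  eLpNorm (fun x => matrixNorm (M x)) ∞ volume

/-- `u` is a solution on `[0,T]`, with pressure `p` and initial datum `u₀`, of the incompressible
Euler equations on `ℝ³`, in the class `C([0,T]; H^s) ∩ C¹([0,T]; H^{s-1})`.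

For `s > 5/2` each `u(t)` and each `∂ₜ u(t)` is identified with its continuous representative, so
that `u(t)` is `C¹` in space and the equations hold at every point. -/
structure IsSolution (s T : ℝ) (u : ℝ → Space → Space) (p : ℝ → Space → ℝ)
    (u₀ : Space → Space) : Prop where
  velocity_space : ∀ t ∈ Icc 0 T, ContDiff ℝ 1 (u t)
  velocity_time : ∀ t ∈ Icc 0 T, ∀ x, DifferentiableWithinAt ℝ (fun τ => u τ x) (Icc 0 T) t
  pressure_space : ∀ t ∈ Icc 0 T, ContDiff ℝ 1 (p t)
  mem_class : ContinuousInSobolev s T u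
  time_derivative : HasDerivInSobolev (s - 1) T u (timeDeriv T u)
  time_derivative_mem_class : ContinuousInSobolev (s - 1) T (timeDeriv T u)
  momentum : ∀ t ∈ Icc 0 T, ∀ x,
    timeDeriv T u t x + fderiv ℝ (u t) x (u t x) + gradient (p t) x = 0
  incompressible : ∀ t ∈ Icc 0 T, ∀ x, divergence (u t) x = 0
  initial : u 0 = u₀

/-- The `δ`-Hölder seminorm `sup_{0 < |x-y| < L} |w(x) - w(y)| / |x-y|^δ`, possibly `∞`. -/
def holderSeminorm (L δ : ℝ) (w : Space → Space) : ℝ≥0∞ :=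
  ⨆ (x : Space) (y : Space) (_ : x ≠ y) (_ : ‖x - y‖ < L),
    ‖w x - w y‖ₑ / ENNReal.ofReal (‖x - y‖ ^ δ)

/-- The length scale `ℓ_δ = min { L, (‖∇ ∧ v‖_{C^δ} / ‖u₀‖_{L²})^{-2/(2δ+5)} }` of a velocity
field `v`, with values in `[0,L]`. In `[0,∞]` one has `0/0 = 0`, `0^{-a} = ∞` and `∞^{-a} = 0`
for `a > 0`; so `ℓ_δ = L` when the seminorm vanishes, and `ℓ_δ = 0` when it is infinite
and `0 < ‖u₀‖_{L²} < ∞`. -/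
def lengthScale (L δ : ℝ) (u₀ v : Space → Space) : ℝ≥0∞ :=
  min (ENNReal.ofReal L)
    ((holderSeminorm L δ (curl v) / eLpNorm u₀ 2 volume) ^ (-(2 / (2 * δ + 5)) : ℝ))

end

end EulerFlow

namespace EulerFlow

noncomputable section

/-! The proof combines a static estimate, valid for any solenoidal field `v` in `L²`, with
conservation of energy.

Static estimate (`exists_velGrad_estimate`). Let `G(r)` be the average of `∂ᵢvⱼ(x + r z)` against a
radial mollifier `φ(z)`. Then `G(0) = ∂ᵢvⱼ(x)`. At `r = ρ` one integration by parts and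
Cauchy–Schwarz give `|G(ρ)| ≲ ρ^(-5/2) ‖v‖₂`. Since `-z φ = ∇ψ` with `ψ` compactly supported, `G'(r)
= r⁻¹ Σₖ ∫ ∂ᵢ∂ₖψ(z) ∂ₖvⱼ(x + r z) dz`. Incompressibility permits replacing `∂ₖvⱼ` by the vorticity
entry `∂ₖvⱼ - ∂ⱼvₖ`, and since the kernels have mean zero its value at `x` may be subtracted. Hence
`|G'(r)| ≲ Ω r^(δ-1)`, where `Ω` is the Hölder constant. Integration over `(0, ρ)` yields `Ω ρ^δ /
δ`, the source of the factor `1/δ`. The length scale is the `ρ` at which this is controlled by the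
energy term (`exists_lengthScale_eq`).

Energy (`eLpNorm_eq_initial`). With `H = |u|²/2 + p`, the equations give `u · ∂ₜu = -u · ∇H`. No
decay of `p` is assumed, but `∇H` is in `L²`: `∇p` is read off from the equation and `Du` is bounded
for `s > 5/2`. A solenoidal `L²` field is orthogonal to such a gradient
(`integral_fderiv_apply_eq_zero`), so the `L²` norm is constant in time. -/

/-! ### Partial derivatives and integration by parts. -/

/-- The partial derivative `∂ᵢ g` of a scalar function. -/
def partialDeriv (i : Fin 3) (g : Space → ℝ) (x : Space) : ℝ := fderiv ℝ g x (basisVec i)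

theorem contDiff_partialDeriv {g : Space → ℝ} (hg : ContDiff ℝ (⊤ : ℕ∞) g) (i : Fin 3) :
    ContDiff ℝ (⊤ : ℕ∞) (partialDeriv i g) :=
  (hg.fderiv_right (m := (⊤ : ℕ∞)) (by simp)).clm_apply contDiff_const

theorem continuous_partialDeriv {g : Space → ℝ} (hg : ContDiff ℝ 1 g) (i : Fin 3) :
    Continuous (partialDeriv i g) :=
  (hg.continuous_fderiv (by simp)).clm_apply continuous_const

theorem tsupport_partialDeriv_subset (g : Space → ℝ) (i : Fin 3) :
    tsupport (partialDeriv i g) ⊆ tsupport g :=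
  tsupport_fderiv_apply_subset ℝ (basisVec i)

theorem hasCompactSupport_partialDeriv {g : Space → ℝ} (hg : HasCompactSupport g) (i : Fin 3) :
    HasCompactSupport (partialDeriv i g) :=
  hg.mono' ((subset_tsupport _).trans (tsupport_partialDeriv_subset g i))

theorem eq_sum_basisVec (z : Space) : z = ∑ k, z k • basisVec k := by
  ext i
  simp [basisVec, Finset.sum_apply, Pi.single_apply]

theorem fderiv_eq_sum_partialDeriv (g : Space → ℝ) (x z : Space) :
    fderiv ℝ g x z = ∑ k, z k * partialDeriv k g x := by
  conv_lhs => rw [eq_sum_basisVec z]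
  simp [map_sum, partialDeriv]

theorem partialDeriv_comm {g : Space → ℝ} (hg : ContDiff ℝ (⊤ : ℕ∞) g) (i j : Fin 3) (x : Space) :
    partialDeriv i (partialDeriv j g) x = partialDeriv j (partialDeriv i g) x := by
  have hd : DifferentiableAt ℝ (fderiv ℝ g) x :=
    ((hg.fderiv_right (m := 1) (by norm_cast)).differentiable (by simp)) x
  have key : ∀ a b : Fin 3, partialDeriv a (partialDeriv b g) x
      = fderiv ℝ (fderiv ℝ g) x (basisVec a) (basisVec b) := by
    intro a b
    unfold partialDeriv
    rw [fderiv_clm_apply hd (differentiableAt_const _)]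
    simp
  rw [key, key]
  exact (hg.contDiffAt.isSymmSndFDerivAt (by simp; norm_cast)) _ _

theorem integrable_mul_of_hasCompactSupport {g f : Space → ℝ} (hg : Continuous g)
    (hgs : HasCompactSupport g) (hf : Continuous f) : Integrable (fun x => g x * f x) :=
  (hg.mul hf).integrable_of_hasCompactSupport hgs.mul_right

theorem integral_partialDeriv_mul {g f : Space → ℝ} (hg : ContDiff ℝ 1 g)
    (hgs : HasCompactSupport g) (hf : ContDiff ℝ 1 f) (i : Fin 3) :
    ∫ x, partialDeriv i g x * f x = -∫ x, g x * partialDeriv i f x := by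
  have := integral_mul_fderiv_eq_neg_fderiv_mul_of_integrable (μ := (volume : Measure Space))
    (f := g) (g := f) (v := basisVec i)
    (integrable_mul_of_hasCompactSupport (continuous_partialDeriv hg i)
      (hasCompactSupport_partialDeriv hgs i) hf.continuous)
    (integrable_mul_of_hasCompactSupport hg.continuous hgs (continuous_partialDeriv hf i))
    (integrable_mul_of_hasCompactSupport hg.continuous hgs hf.continuous)
    (fun x _ => hg.differentiable (by simp) x) (fun x _ => hf.differentiable (by simp) x)
  simp only [partialDeriv]
  rw [this, neg_neg]

/-- Since `f` is only `C¹`, both second derivatives are placed on `g`, where they commute. This is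
how incompressibility enters the gradient estimate. -/
theorem integral_partialDeriv_mul_partialDeriv_swap {g f : Space → ℝ}
    (hg : ContDiff ℝ (⊤ : ℕ∞) g) (hgs : HasCompactSupport g) (hf : ContDiff ℝ 1 f)
    (j k : Fin 3) :
    ∫ x, partialDeriv k g x * partialDeriv j f x
      = ∫ x, partialDeriv j g x * partialDeriv k f x := by
  have h1 := integral_partialDeriv_mul ((contDiff_partialDeriv hg k).of_le (by norm_cast))
    (hasCompactSupport_partialDeriv hgs k) hf j
  have h2 := integral_partialDeriv_mul ((contDiff_partialDeriv hg j).of_le (by norm_cast))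
    (hasCompactSupport_partialDeriv hgs j) hf k
  simp only [partialDeriv_comm hg j k] at h1
  linarith

theorem integral_partialDeriv_eq_zero {g : Space → ℝ} (hg : ContDiff ℝ 1 g)
    (hgs : HasCompactSupport g) (i : Fin 3) : ∫ x, partialDeriv i g x = 0 := by
  have := integral_partialDeriv_mul hg hgs (contDiff_const (c := (1 : ℝ))) i
  simpa [partialDeriv] using this

/-! ### The mollifier and averages over dilated balls. -/

/-- A smooth radial mollifier `φ`, together with the compactly supported potential `ψ` of
the field `-z φ(z)`. -/
theorem exists_mollifier_potential : ∃ φ ψ : Space → ℝ,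
    ContDiff ℝ (⊤ : ℕ∞) φ ∧ ContDiff ℝ (⊤ : ℕ∞) ψ ∧ HasCompactSupport φ ∧ HasCompactSupport ψ ∧
    tsupport ψ ⊆ Metric.ball 0 1 ∧ ∫ z, φ z = 1 ∧
    ∀ k z, partialDeriv k ψ z = -(z k * φ z) := by
  set h : ℝ → ℝ := fun t => Real.smoothTransition (1 - 2 * t) with hh
  have hsm : ContDiff ℝ (⊤ : ℕ∞) h := Real.smoothTransition.contDiff.comp (by fun_prop)
  have hanti : Antitone h := fun a b hab => Real.smoothTransition.monotone (by linarith)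
  have hd : ContDiff ℝ (⊤ : ℕ∞) (deriv h) := by
    have := (contDiff_infty_iff_deriv.1 hsm).2
    exact this
  have hnsq : ContDiff ℝ (⊤ : ℕ∞) (fun z : Space => ‖z‖ ^ 2) := contDiff_norm_sq ℝ
  set ψ : Space → ℝ := fun z => h (‖z‖ ^ 2) with hψ
  set φ : Space → ℝ := fun z => -2 * deriv h (‖z‖ ^ 2) with hφ
  have cψ : ContDiff ℝ (⊤ : ℕ∞) ψ := hsm.comp hnsq
  have cφ : ContDiff ℝ (⊤ : ℕ∞) φ := contDiff_const.mul (hd.comp hnsq)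
  have hgrad : ∀ z v, fderiv ℝ ψ z v = -(inner ℝ z v * φ z) := by
    intro z v
    have h1 : HasFDerivAt (fun z : Space => ‖z‖ ^ 2) (2 • innerSL ℝ z) z :=
      (hasStrictFDerivAt_norm_sq z).hasFDerivAt
    have h2 : HasDerivAt h (deriv h (‖z‖ ^ 2)) (‖z‖ ^ 2) :=
      (hsm.differentiable (by simp) _).hasDerivAt
    have h3 := h2.comp_hasFDerivAt z h1
    rw [show ψ = h ∘ fun z : Space => ‖z‖ ^ 2 from rfl, h3.fderiv]
    simp [hφ]
    ring
  -- The profile `h` vanishes on `[1/2, ∞)`, and `(3/4)² > 1/2`.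
  have hsupp : ∀ z : Space, 3 / 4 < ‖z‖ → ψ z = 0 := by
    intro z hz
    apply Real.smoothTransition.zero_of_nonpos
    nlinarith
  have hts : tsupport ψ ⊆ Metric.closedBall 0 (3 / 4) := by
    apply closure_minimal _ Metric.isClosed_closedBall
    intro z hz
    by_contra hcon
    exact hz (hsupp z (by simpa using hcon))
  have hψs : HasCompactSupport ψ :=
    (isCompact_closedBall _ _).of_isClosed_subset (isClosed_tsupport _) hts
  have hφs : HasCompactSupport φ := by
    apply HasCompactSupport.intro (isCompact_closedBall (0 : Space) (3 / 4))
    intro z hz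
    have hz' : 3 / 4 < ‖z‖ := by simpa using hz
    have hz0 : deriv h (‖z‖ ^ 2) = 0 := by
      have : h =ᶠ[𝓝 (‖z‖ ^ 2)] fun _ => 0 := by
        filter_upwards [lt_mem_nhds (show (1 / 2 : ℝ) < ‖z‖ ^ 2 by nlinarith)] with t ht
        exact Real.smoothTransition.zero_of_nonpos (by linarith)
      rw [this.deriv_eq]; simp
    simp [hφ, hz0]
  have hnn : ∀ z, 0 ≤ φ z := by
    intro z
    have : deriv h (‖z‖ ^ 2) ≤ 0 := hanti.deriv_nonpos
    simp only [hφ]; linarith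
  have hint : Integrable φ := cφ.continuous.integrable_of_hasCompactSupport hφs
  -- If the integral vanished, then `φ = 0`, hence `∇ψ = 0`, although `ψ` is `1` at the origin and
  -- `0` at a unit vector. Positivity allows `φ` and `ψ` to be normalised together.
  have hpos : 0 < ∫ z, φ z := by
    rcases (integral_nonneg (μ := volume) (show 0 ≤ φ from hnn)).lt_or_eq with h0 | h0
    · exact h0
    · exfalso
      have hae := (integral_eq_zero_iff_of_nonneg (show 0 ≤ φ from hnn) hint).1 h0.symm
      have hz : φ = 0 := (Continuous.ae_eq_iff_eq volume cφ.continuous continuous_const).1 hae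
      have hcst := is_const_of_fderiv_eq_zero (𝕜 := ℝ) (cψ.differentiable (by simp)) (fun z => by
        ext v; simp [hgrad, hz]) 0 (basisVec 0)
      have e1 : ψ 0 = 1 := by simp [hψ, hh]
      have e2 : ψ (basisVec 0) = 0 := hsupp _ (by simp [basisVec]; norm_num)
      rw [e1, e2] at hcst
      exact one_ne_zero hcst
  refine ⟨fun z => (∫ z, φ z)⁻¹ * φ z, fun z => (∫ z, φ z)⁻¹ * ψ z, contDiff_const.mul cφ,
    contDiff_const.mul cψ, hφs.mul_left, hψs.mul_left, ?_, ?_, ?_⟩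
  · refine (closure_mono ?_).trans (hts.trans (Metric.closedBall_subset_ball (by norm_num)))
    exact Function.support_mul_subset_right _ _
  · rw [integral_const_mul, inv_mul_cancel₀ hpos.ne']
  · intro k z
    unfold partialDeriv
    rw [fderiv_const_mul (cψ.differentiable (by simp) z)]
    simp only [smul_apply, hgrad, basisVec, smul_eq_mul]
    rw [EuclideanSpace.inner_single_right]
    simp
    ring

theorem hasDerivAt_integral_mul_comp_dilate {K f : Space → ℝ} (hK : Continuous K)
    (hKs : HasCompactSupport K) (hf : ContDiff ℝ 1 f) (x : Space) (r : ℝ) :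
    HasDerivAt (fun r : ℝ => ∫ z, K z * f (x + r • z))
      (∫ z, K z * fderiv ℝ f (x + r • z) z) r := by
  have hf' : Continuous (fderiv ℝ f) := hf.continuous_fderiv (by simp)
  obtain ⟨M, hM⟩ : ∃ M, ∀ p ∈ Metric.closedBall r 1 ×ˢ tsupport K,
      ‖K p.2 * fderiv ℝ f (x + p.1 • p.2) p.2‖ ≤ M := by
    apply ((isCompact_closedBall r 1).prod hKs).exists_bound_of_continuousOn
    apply Continuous.continuousOn
    fun_prop
  refine (hasDerivAt_integral_of_dominated_loc_of_deriv_le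
    (F := fun r z => K z * f (x + r • z))
    (F' := fun r z => K z * fderiv ℝ f (x + r • z) z)
    (bound := (tsupport K).indicator fun _ => M) (Metric.ball_mem_nhds r one_pos)
    ?_ ?_ ?_ ?_ ?_ ?_).2
  · filter_upwards with r'
    exact (hK.mul (hf.continuous.comp (by fun_prop))).aestronglyMeasurable
  · exact integrable_mul_of_hasCompactSupport hK hKs (hf.continuous.comp (by fun_prop))
  · exact Continuous.aestronglyMeasurable (by fun_prop)
  · filter_upwards with z r' hr'
    by_cases hz : z ∈ tsupport K
    · simpa [hz] using hM (r', z) ⟨Metric.ball_subset_closedBall hr', hz⟩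
    · simp [hz, image_eq_zero_of_notMem_tsupport hz]
  · exact (integrable_indicator_iff (isClosed_tsupport K).measurableSet).2
      (integrableOn_const hKs.measure_ne_top)
  · filter_upwards with z r' _
    apply HasDerivAt.const_mul
    have h1 : HasFDerivAt f (fderiv ℝ f (x + r' • z)) (x + r' • z) :=
      (hf.differentiable (by simp) _).hasFDerivAt
    have h2 : HasDerivAt (fun r : ℝ => x + r • z) z r' := by
      simpa using ((hasDerivAt_id r').smul_const z).const_add x
    exact h1.comp_hasDerivAt r' h2

theorem contDiff_comp_dilate {f : Space → ℝ} (hf : ContDiff ℝ 1 f) (x : Space) (r : ℝ) :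
    ContDiff ℝ 1 fun z : Space => f (x + r • z) :=
  hf.comp (by fun_prop)

theorem partialDeriv_comp_dilate {f : Space → ℝ} (hf : ContDiff ℝ 1 f) (x : Space) (r : ℝ)
    (i : Fin 3) (z : Space) :
    partialDeriv i (fun z => f (x + r • z)) z = r * partialDeriv i f (x + r • z) := by
  have h1 : HasFDerivAt f (fderiv ℝ f (x + r • z)) (x + r • z) :=
    (hf.differentiable (by simp) _).hasFDerivAt
  have h2 : HasFDerivAt (fun z : Space => x + r • z) (r • ContinuousLinearMap.id ℝ Space) z :=
    ((hasFDerivAt_id z).const_smul r).const_add x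
  have h3 := h1.comp z h2
  unfold partialDeriv
  rw [show (fun z : Space => f (x + r • z)) = f ∘ fun z => x + r • z from rfl, h3.fderiv]
  simp

/-- The averages of `∂ᵢ f` at scale `r` are, up to a factor, averages of `f` against `∂ᵢ φ`. -/
theorem integral_mul_partialDeriv_dilate {φ f : Space → ℝ} (hφ : ContDiff ℝ (⊤ : ℕ∞) φ)
    (hφs : HasCompactSupport φ) (hf : ContDiff ℝ 1 f) (x : Space) {r : ℝ} (hr : r ≠ 0)
    (i : Fin 3) :
    ∫ z, φ z * partialDeriv i f (x + r • z)
      = -(r⁻¹ * ∫ z, partialDeriv i φ z * f (x + r • z)) := by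
  have h := integral_partialDeriv_mul (hφ.of_le (by norm_cast)) hφs (contDiff_comp_dilate hf x r) i
  simp only [partialDeriv_comp_dilate hf] at h
  rw [h]
  simp_rw [mul_left_comm (φ _) r]
  rw [integral_const_mul]
  field_simp

theorem partialDeriv_potential {φ ψ : Space → ℝ} (hφ : ContDiff ℝ (⊤ : ℕ∞) φ)
    (hψφ : ∀ k z, partialDeriv k ψ z = -(z k * φ z)) (i k : Fin 3) (z : Space) :
    partialDeriv i (partialDeriv k ψ) z
      = -((if i = k then φ z else 0) + z k * partialDeriv i φ z) := by
  have e : partialDeriv k ψ = fun z => -(z k * φ z) := funext (hψφ k)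
  have h1 : HasFDerivAt (fun z : Space => z k) (EuclideanSpace.proj (𝕜 := ℝ) k) z :=
    (EuclideanSpace.proj (𝕜 := ℝ) k).hasFDerivAt
  have h2 : HasFDerivAt φ (fderiv ℝ φ z) z := (hφ.differentiable (by simp) z).hasFDerivAt
  have h3 := (h1.mul h2).neg
  rw [e]
  unfold partialDeriv
  rw [show (fun z : Space => -(z k * φ z)) = -((fun z : Space => z k) * φ) from rfl, h3.fderiv]
  by_cases hik : i = k
  · subst hik; simp [basisVec]; ring
  · simp [basisVec, hik, Ne.symm hik]

/-- As `f` is only `C¹`, its derivative is first moved onto `φ`, and `-r⁻¹ ∫ ∂ᵢφ f(x + r z)` is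
differentiated instead. The two terms of the product rule recombine through `∂ᵢ∂ₖψ = -(δᵢₖ φ + zₖ
∂ᵢφ)`. -/
theorem hasDerivAt_integral_mul_partialDeriv_dilate {φ ψ f : Space → ℝ}
    (hφ : ContDiff ℝ (⊤ : ℕ∞) φ) (hφs : HasCompactSupport φ)
    (hψφ : ∀ k z, partialDeriv k ψ z = -(z k * φ z)) (hf : ContDiff ℝ 1 f) (x : Space)
    {r : ℝ} (hr : r ≠ 0) (i : Fin 3) :
    HasDerivAt (fun r : ℝ => ∫ z, φ z * partialDeriv i f (x + r • z))
      (r⁻¹ * ∑ k, ∫ z, partialDeriv i (partialDeriv k ψ) z * partialDeriv k f (x + r • z)) r := by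
  have hφi := contDiff_partialDeriv hφ i
  have hφis := hasCompactSupport_partialDeriv hφs i
  have hP := hasDerivAt_integral_mul_comp_dilate hφi.continuous hφis hf x r
  have hG := ((hasDerivAt_inv hr).mul hP).neg
  have hev : (fun r : ℝ => ∫ z, φ z * partialDeriv i f (x + r • z)) =ᶠ[𝓝 r]
      -((fun r : ℝ => r⁻¹) * fun r => ∫ z, partialDeriv i φ z * f (x + r • z)) := by
    filter_upwards [isOpen_ne.mem_nhds hr] with r' hr'
    exact integral_mul_partialDeriv_dilate hφ hφs hf x hr' i
  refine (hG.congr_of_eventuallyEq hev).congr_deriv ?_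
  have hcont : ∀ k, Continuous fun z : Space => partialDeriv k f (x + r • z) :=
    fun k => (continuous_partialDeriv hf k).comp (by fun_prop)
  have hi1 : ∀ k, Integrable fun z : Space =>
      (if i = k then φ z else 0) * partialDeriv k f (x + r • z) := by
    intro k
    by_cases hik : i = k
    · simpa [hik] using integrable_mul_of_hasCompactSupport hφ.continuous hφs (hcont k)
    · simp [hik]
  have hi2 : ∀ k, Integrable fun z : Space =>
      partialDeriv i φ z * (z k * partialDeriv k f (x + r • z)) := by
    intro k
    exact integrable_mul_of_hasCompactSupport hφi.continuous hφis
      (Continuous.mul (by fun_prop) (hcont k))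
  have e1 : ∀ k, ∫ z, partialDeriv i (partialDeriv k ψ) z * partialDeriv k f (x + r • z)
      = -((∫ z, (if i = k then φ z else 0) * partialDeriv k f (x + r • z)) +
        ∫ z, partialDeriv i φ z * (z k * partialDeriv k f (x + r • z))) := by
    intro k
    rw [← integral_add (hi1 k) (hi2 k), ← integral_neg]
    congr 1; ext z
    rw [partialDeriv_potential hφ hψφ]; ring
  have e2 : ∫ z, partialDeriv i φ z * fderiv ℝ f (x + r • z) z
      = ∑ k, ∫ z, partialDeriv i φ z * (z k * partialDeriv k f (x + r • z)) := by
    rw [← integral_finsetSum _ fun k _ => hi2 k]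
    congr 1; ext z
    rw [fderiv_eq_sum_partialDeriv, Finset.mul_sum]
  have e3 : ∑ k, ∫ z, (if i = k then φ z else 0) * partialDeriv k f (x + r • z)
      = ∫ z, φ z * partialDeriv i f (x + r • z) := by
    rw [Finset.sum_eq_single i]
    · simp
    · intro b _ hb; simp [Ne.symm hb]
    · simp
  simp_rw [e1]
  rw [Finset.sum_neg_distrib, Finset.sum_add_distrib, e3, ← e2,
    integral_mul_partialDeriv_dilate hφ hφs hf x hr i]
  field_simp

/-! ### Gradient estimate from vorticity and energy. -/

theorem contDiff_component {v : Space → Space} (hv : ContDiff ℝ 1 v) (j : Fin 3) :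
    ContDiff ℝ 1 fun x => v x j :=
  (EuclideanSpace.proj (𝕜 := ℝ) j).contDiff.comp hv

theorem velGrad_eq_partialDeriv {v : Space → Space} (hv : ContDiff ℝ 1 v) (x : Space)
    (i j : Fin 3) : velGrad v x i j = partialDeriv i (fun x => v x j) x := by
  have h1 : HasFDerivAt v (fderiv ℝ v x) x := (hv.differentiable (by simp) x).hasFDerivAt
  have h2 := (EuclideanSpace.proj (𝕜 := ℝ) j).hasFDerivAt.comp x h1
  unfold partialDeriv velGrad
  rw [show (fun x => v x j) = (EuclideanSpace.proj (𝕜 := ℝ) j) ∘ v from rfl, h2.fderiv]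
  simp

/-- Every antisymmetric entry `∂ₖvⱼ - ∂ⱼvₖ` is zero or, up to sign, a component of the vorticity. -/
theorem abs_sub_velGrad_le_norm_sub_curl (v : Space → Space) (x y : Space) (j k : Fin 3) :
    |(velGrad v y k j - velGrad v y j k) - (velGrad v x k j - velGrad v x j k)|
      ≤ ‖curl v y - curl v x‖ := by
  have h : ∀ l, |curl v y l - curl v x l| ≤ ‖curl v y - curl v x‖ := fun l => by
    simpa using PiLp.norm_apply_le (curl v y - curl v x) l
  generalize ‖curl v y - curl v x‖ = M at h ⊢
  have h0 := h 0
  have h1 := h 1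
  have h2 := h 2
  simp only [curl, PiLp.toLp_apply, Matrix.cons_val] at h0 h1 h2
  rw [abs_le] at *
  fin_cases j <;> fin_cases k <;> constructor <;> simp <;> linarith

/-- Cauchy–Schwarz; the dilation scales the `L²` norm on `ℝ³` by `ρ^(-3/2)`. -/
theorem abs_integral_mul_dilate_le {K f : Space → ℝ} (hK : Continuous K)
    (hKs : HasCompactSupport K) (hfc : Continuous f) (hf : MemLp f 2) (x : Space) {ρ : ℝ} (hρ : 0 < ρ) :
    |∫ z, K z * f (x + ρ • z)|
      ≤ √(∫ z, K z ^ 2) * (ρ ^ (-(3 / 2) : ℝ) * √(∫ z, f z ^ 2)) := by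
  have hf2 : Integrable (fun z => f z ^ 2) := hf.integrable_sq
  have hshift : MemLp (fun z => f (x + z)) 2 :=
    hf.comp_measurePreserving (measurePreserving_add_left volume x)
  have hmeas : AEStronglyMeasurable (fun z => f (x + ρ • z)) :=
    (hfc.comp (by fun_prop)).aestronglyMeasurable
  have hsq : Integrable (fun z => f (x + ρ • z) ^ 2) :=
    (hshift.integrable_sq).comp_smul hρ.ne'
  have hg : MemLp (fun z => f (x + ρ • z)) 2 := (memLp_two_iff_integrable_sq hmeas).2 hsq
  have hK2 : MemLp K 2 := hK.memLp_of_hasCompactSupport hKs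
  have h1 := integral_mul_norm_le_Lp_mul_Lq (μ := (volume : Measure Space)) (p := 2) (q := 2)
    (f := K) (g := fun z => f (x + ρ • z)) Real.HolderConjugate.two_two (by simpa using hK2)
    (by simpa using hg)
  have h2 : ∫ z, f (x + ρ • z) ^ 2 = (ρ ^ (-(3 / 2) : ℝ)) ^ 2 * ∫ z, f z ^ 2 := by
    rw [Measure.integral_comp_smul (μ := (volume : Measure Space)) (fun z => f (x + z) ^ 2) ρ,
      integral_add_left_eq_self (fun z => f z ^ 2) x, smul_eq_mul]
    congr 1
    rw [← Real.rpow_mul_natCast hρ.le, finrank_euclideanSpace_fin,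
      abs_of_nonneg (by positivity), ← Real.rpow_natCast, ← Real.rpow_neg hρ.le]
    norm_num
  calc |∫ z, K z * f (x + ρ • z)| ≤ ∫ z, ‖K z‖ * ‖f (x + ρ • z)‖ := by
        simpa [abs_mul] using
          norm_integral_le_integral_norm (μ := volume) fun z => K z * f (x + ρ • z)
    _ ≤ √(∫ z, K z ^ 2) * √(∫ z, f (x + ρ • z) ^ 2) := by
        simpa [Real.sqrt_eq_rpow] using h1
    _ = _ := by
        rw [h2, Real.sqrt_mul (by positivity), Real.sqrt_sq (by positivity)]

/-- Interior estimate for the gradient of a solenoidal field by its vorticity. -/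
theorem exists_velGrad_estimate : ∃ C : ℝ, 0 < C ∧
    ∀ (v : Space → Space), ContDiff ℝ 1 v → MemLp v 2 → (∀ x, divergence v x = 0) →
    ∀ (δ ρ Ω : ℝ), 0 < δ → 0 < ρ → 0 ≤ Ω →
    (∀ x y, ‖x - y‖ < ρ → ‖curl v x - curl v y‖ ≤ Ω * ‖x - y‖ ^ δ) →
    ∀ x i j, |velGrad v x i j|
      ≤ C * (Ω * ρ ^ δ / δ + ρ ^ (-(5 / 2) : ℝ) * (eLpNorm v 2 volume).toReal) := by
  obtain ⟨φ, ψ, hφ, hψ, hφs, hψs, hball, hone, hψφ⟩ := exists_mollifier_potential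
  set K : Fin 3 → Fin 3 → Space → ℝ := fun i k => partialDeriv i (partialDeriv k ψ) with hKdef
  have hKc : ∀ i k, Continuous (K i k) := fun i k =>
    (contDiff_partialDeriv (contDiff_partialDeriv hψ k) i).continuous
  have hKs : ∀ i k, HasCompactSupport (K i k) := fun i k =>
    hasCompactSupport_partialDeriv (hasCompactSupport_partialDeriv hψs k) i
  have hKint : ∀ i k, Integrable fun z => |K i k z| := fun i k =>
    ((hKc i k).integrable_of_hasCompactSupport (hKs i k)).abs
  set A : ℝ := ∑ i, ∑ k, ∫ z, |K i k z| with hA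
  set B : ℝ := ∑ i, √(∫ z, partialDeriv i φ z ^ 2) with hB
  have hA0 : 0 ≤ A := Finset.sum_nonneg fun i _ => Finset.sum_nonneg fun k _ =>
    integral_nonneg fun z => abs_nonneg _
  have hB0 : 0 ≤ B := Finset.sum_nonneg fun i _ => Real.sqrt_nonneg _
  -- `A` serves the vorticity term and `B` the energy term; the `1` only makes the constant
  -- positive.
  refine ⟨A + B + 1, by positivity, ?_⟩
  intro v hv hv2 hdiv δ ρ Ω hδ hρ hΩ hhol x i j
  have hvc := contDiff_component hv
  set N := (eLpNorm v 2 volume).toReal with hN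
  set G : ℝ → ℝ := fun r => ∫ z, φ z * partialDeriv i (fun x => v x j) (x + r • z) with hG
  set G' : ℝ → ℝ := fun r =>
    r⁻¹ * ∑ k, ∫ z, K i k z * partialDeriv k (fun x => v x j) (x + r • z) with hG'
  have hderiv : ∀ r, 0 < r → HasDerivAt G (G' r) r := fun r hr =>
    hasDerivAt_integral_mul_partialDeriv_dilate hφ hφs hψφ (hvc j) x hr.ne' i
  -- the derivative only sees the oscillation of the vorticity
  have hrepr : ∀ r, 0 < r → G' r = r⁻¹ * ∑ k, ∫ z, K i k z *
      ((velGrad v (x + r • z) k j - velGrad v (x + r • z) j k)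
        - (velGrad v x k j - velGrad v x j k)) := by
    intro r hr
    have hpc : ∀ k l, Continuous fun z : Space => partialDeriv k (fun x => v x l) (x + r • z) :=
      fun k l => (continuous_partialDeriv (hvc l) k).comp (by fun_prop)
    have hint : ∀ k l m, Integrable fun z : Space =>
        K i m z * partialDeriv k (fun x => v x l) (x + r • z) := fun k l m =>
      integrable_mul_of_hasCompactSupport (hKc i m) (hKs i m) (hpc k l)
    -- Exchanging `∂ₖ` and `∂ⱼ` turns the sum into the integral of `K i j` against the divergence.
    have hzero : ∑ k, ∫ z, K i k z * partialDeriv j (fun x => v x k) (x + r • z) = 0 := by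
      have hswap : ∀ k, ∫ z, K i k z * partialDeriv j (fun x => v x k) (x + r • z)
          = ∫ z, K i j z * partialDeriv k (fun x => v x k) (x + r • z) := by
        intro k
        have hs := integral_partialDeriv_mul_partialDeriv_swap (contDiff_partialDeriv hψ i)
          (hasCompactSupport_partialDeriv hψs i) (contDiff_comp_dilate (hvc k) x r) j k
        simp only [partialDeriv_comp_dilate (hvc k), mul_left_comm _ r] at hs
        rw [integral_const_mul, integral_const_mul] at hs
        have hs' := mul_left_cancel₀ hr.ne' hs
        simp only [hKdef]
        simp_rw [partialDeriv_comm hψ i k, partialDeriv_comm hψ i j]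
        exact hs'
      simp_rw [hswap]
      rw [← integral_finsetSum _ fun k _ => hint k k j]
      have : ∀ z, ∑ k, K i j z * partialDeriv k (fun x => v x k) (x + r • z) = 0 := by
        intro z
        rw [← Finset.mul_sum]
        have := hdiv (x + r • z)
        simp only [divergence, velGrad_eq_partialDeriv hv] at this
        rw [this, mul_zero]
      simp [this]
    -- The kernels are derivatives of compactly supported functions, so they annihilate constants.
    have hcst : ∀ k, ∫ z, K i k z * (velGrad v x k j - velGrad v x j k) = 0 := by
      intro k
      rw [integral_mul_const, integral_partialDeriv_eq_zero
        ((contDiff_partialDeriv hψ k).of_le (by norm_cast))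
        (hasCompactSupport_partialDeriv hψs k), zero_mul]
    have hsplit : ∀ k, ∫ z, K i k z *
        ((velGrad v (x + r • z) k j - velGrad v (x + r • z) j k)
          - (velGrad v x k j - velGrad v x j k))
        = (∫ z, K i k z * partialDeriv k (fun x => v x j) (x + r • z))
          - ∫ z, K i k z * partialDeriv j (fun x => v x k) (x + r • z) := by
      intro k
      have h1 := integral_sub (hint k j k) (hint j k k)
      have h2 := integral_sub ((hint k j k).sub (hint j k k))
        (((hKc i k).integrable_of_hasCompactSupport (hKs i k)).mul_const
          (velGrad v x k j - velGrad v x j k))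
      rw [hcst k, sub_zero] at h2
      rw [← h1]
      refine Eq.trans ?_ h2
      congr 1; ext z
      simp only [velGrad_eq_partialDeriv hv, Pi.sub_apply]
      ring
    simp_rw [hsplit, Finset.sum_sub_distrib]
    rw [hzero, sub_zero]
  have hbound : ∀ r, 0 < r → r ≤ ρ → |G' r| ≤ A * Ω * r ^ (δ - 1) := by
    intro r hr hrρ
    have hk : ∀ k, |∫ z, K i k z *
        ((velGrad v (x + r • z) k j - velGrad v (x + r • z) j k)
          - (velGrad v x k j - velGrad v x j k))| ≤ (∫ z, |K i k z|) * (Ω * r ^ δ) := by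
      intro k
      rw [← integral_mul_const, ← Real.norm_eq_abs]
      refine norm_integral_le_of_norm_le ((hKint i k).mul_const _) (Eventually.of_forall ?_)
      intro z
      rw [Real.norm_eq_abs, abs_mul]
      by_cases hz : z ∈ tsupport ψ
      · gcongr
        have hz1 : ‖z‖ < 1 := by simpa using hball hz
        have hsub : ‖x + r • z - x‖ = r * ‖z‖ := by
          simp [norm_smul, abs_of_pos hr]
        calc _ ≤ ‖curl v (x + r • z) - curl v x‖ := abs_sub_velGrad_le_norm_sub_curl _ _ _ _ _
          _ ≤ Ω * (r * ‖z‖) ^ δ := by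
              rw [← hsub]
              apply hhol
              rw [hsub]
              nlinarith [norm_nonneg z]
          _ ≤ Ω * r ^ δ := by
              gcongr
              nlinarith [norm_nonneg z]
      · have : K i k z = 0 := image_eq_zero_of_notMem_tsupport fun h =>
          hz (tsupport_partialDeriv_subset _ _ (tsupport_partialDeriv_subset _ _ h))
        simp [this]
    rw [hrepr r hr, abs_mul, abs_of_pos (inv_pos.2 hr)]
    calc _ ≤ r⁻¹ * ∑ k, (∫ z, |K i k z|) * (Ω * r ^ δ) := by
          gcongr
          exact (Finset.abs_sum_le_sum_abs _ _).trans (Finset.sum_le_sum fun k _ => hk k)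
      _ = (∑ k, ∫ z, |K i k z|) * (Ω * (r⁻¹ * r ^ δ)) := by rw [← Finset.sum_mul]; ring
      _ ≤ A * (Ω * (r⁻¹ * r ^ δ)) := by
          gcongr
          exact Finset.single_le_sum (f := fun i => ∑ k, ∫ z, |K i k z|)
            (fun i _ => Finset.sum_nonneg fun k _ => integral_nonneg fun z => abs_nonneg _)
            (Finset.mem_univ i)
      _ = A * Ω * r ^ (δ - 1) := by
          rw [Real.rpow_sub hr, Real.rpow_one]; field_simp
  have hpcj : Continuous (partialDeriv i fun x => v x j) := continuous_partialDeriv (hvc j) i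
  -- Continuity is needed up to `r = 0`, where the formula for `G'` is not available.
  have hGcont : Continuous G := by
    have h1 : G = fun r => ∫ z in tsupport φ, φ z * partialDeriv i (fun x => v x j) (x + r • z) := by
      ext r
      refine (setIntegral_eq_integral_of_forall_compl_eq_zero fun z hz => ?_).symm
      rw [image_eq_zero_of_notMem_tsupport hz, zero_mul]
    rw [h1]
    refine continuous_parametric_integral_of_continuous
      (f := fun (r : ℝ) z => φ z * partialDeriv i (fun x => v x j) (x + r • z)) ?_ hφs
    exact (hφ.continuous.comp continuous_snd).mul (hpcj.comp (by fun_prop))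
  have hG0 : G 0 = velGrad v x i j := by
    simp only [hG, zero_smul, add_zero, integral_mul_const, hone, one_mul]
    rw [velGrad_eq_partialDeriv hv]
  have hGρ : |G ρ| ≤ B * (ρ ^ (-(5 / 2) : ℝ) * N) := by
    have hvj : MemLp (fun x => v x j) 2 := hv2.continuousLinearMap_comp (EuclideanSpace.proj (𝕜 := ℝ) j)
    have hNj : √(∫ z, v z j ^ 2) ≤ N := by
      have h1 : √(∫ z, v z j ^ 2) = (eLpNorm (fun x => v x j) 2 volume).toReal := by
        rw [hvj.eLpNorm_eq_integral_rpow_norm (by simp) (by simp),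
          ENNReal.toReal_ofReal (by positivity)]
        simp [Real.sqrt_eq_rpow]
      rw [h1]
      exact ENNReal.toReal_mono hv2.eLpNorm_ne_top
        (eLpNorm_mono fun x => PiLp.norm_apply_le (v x) j)
    have h2 := abs_integral_mul_dilate_le (contDiff_partialDeriv hφ i).continuous
      (hasCompactSupport_partialDeriv hφs i) (hvc j).continuous hvj x hρ
    simp only [hG]
    rw [integral_mul_partialDeriv_dilate hφ hφs (hvc j) x hρ.ne' i, abs_neg, abs_mul,
      abs_of_pos (inv_pos.2 hρ)]
    calc _ ≤ ρ⁻¹ * (B * (ρ ^ (-(3 / 2) : ℝ) * N)) := by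
          gcongr
          refine h2.trans ?_
          gcongr
          exact Finset.single_le_sum (f := fun i => √(∫ z, partialDeriv i φ z ^ 2))
            (fun i _ => Real.sqrt_nonneg _) (Finset.mem_univ i)
      _ = _ := by
          rw [show (-(5 / 2) : ℝ) = -(3 / 2) - 1 by norm_num, Real.rpow_sub hρ, Real.rpow_one]
          field_simp
  -- A primitive of the bound on `|G'|`. Monotonicity of `G ± b` replaces integration of `G'`, whose
  -- bound may be singular at `0`.
  set b : ℝ → ℝ := fun r => A * Ω * (r ^ δ / δ) with hb
  have hbcont : Continuous b := by
    have := Real.continuous_rpow_const hδ.le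
    fun_prop
  have hbd : ∀ r, 0 < r → HasDerivAt b (A * Ω * r ^ (δ - 1)) r := by
    intro r hr
    have := ((Real.hasDerivAt_rpow_const (p := δ) (Or.inl hr.ne')).div_const δ).const_mul (A * Ω)
    refine this.congr_deriv ?_
    field_simp
  have hb0 : b 0 = 0 := by simp [hb, Real.zero_rpow hδ.ne']
  have hanti : AntitoneOn (fun r => G r - b r) (Icc 0 ρ) := by
    apply antitoneOn_of_deriv_nonpos (convex_Icc 0 ρ) (hGcont.sub hbcont).continuousOn
    · intro r hr
      rw [interior_Icc] at hr
      exact ((hderiv r hr.1).sub (hbd r hr.1)).differentiableAt.differentiableWithinAt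
    · intro r hr
      rw [interior_Icc] at hr
      rw [((hderiv r hr.1).sub (hbd r hr.1)).deriv]
      linarith [(abs_le.1 (hbound r hr.1 hr.2.le)).2]
  have hmono : MonotoneOn (fun r => G r + b r) (Icc 0 ρ) := by
    apply monotoneOn_of_deriv_nonneg (convex_Icc 0 ρ) (hGcont.add hbcont).continuousOn
    · intro r hr
      rw [interior_Icc] at hr
      exact ((hderiv r hr.1).add (hbd r hr.1)).differentiableAt.differentiableWithinAt
    · intro r hr
      rw [interior_Icc] at hr
      rw [((hderiv r hr.1).add (hbd r hr.1)).deriv]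
      linarith [(abs_le.1 (hbound r hr.1 hr.2.le)).1]
  have m0 : (0 : ℝ) ∈ Icc 0 ρ := ⟨le_rfl, hρ.le⟩
  have m1 : ρ ∈ Icc 0 ρ := ⟨hρ.le, le_rfl⟩
  have e1 := hanti m0 m1 hρ.le
  have e2 := hmono m0 m1 hρ.le
  simp only [hb0, sub_zero, add_zero, hG0] at e1 e2
  have hN0 : 0 ≤ N := ENNReal.toReal_nonneg
  have p1 : 0 ≤ Ω * ρ ^ δ / δ := by positivity
  have p2 : 0 ≤ ρ ^ (-(5 / 2) : ℝ) * N := by positivity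
  have hbρ : b ρ = A * (Ω * ρ ^ δ / δ) := by simp only [hb]; ring
  rw [abs_le] at hGρ ⊢
  constructor <;> nlinarith [mul_nonneg hA0 p2, mul_nonneg hB0 p1]

/-! ### Consequences of finite Sobolev norms: square integrability and Lipschitz bounds. -/

theorem norm_complexify (f : Space → Space) (x : Space) : ‖complexify f x‖ = ‖f x‖ := by
  simp [complexify, EuclideanSpace.norm_eq]

theorem complexify_sub (f : Space → Space) (x y : Space) :
    ‖complexify f x - complexify f y‖ = ‖f x - f y‖ := by
  simp only [complexify, EuclideanSpace.norm_eq, PiLp.sub_apply, ← Complex.ofReal_sub,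
    Complex.norm_real]

theorem eLpNorm_complexify (f : Space → Space) :
    eLpNorm (complexify f) 2 volume = eLpNorm f 2 volume :=
  eLpNorm_congr_norm_ae (Eventually.of_forall (norm_complexify f))

theorem memLp_complexify_of_sobolevNorm_lt_top {s : ℝ} {f : Space → Space}
    (h : sobolevNorm s f < ∞) : MemLp (complexify f) 2 volume := by
  by_contra hcon
  simp [sobolevNorm, hcon] at h

theorem memLp_of_complexify {f : Space → Space} (h : MemLp (complexify f) 2 volume) :
    MemLp f 2 volume := by
  refine ⟨?_, by rw [← eLpNorm_complexify]; exact h.2⟩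
  have hc : Continuous fun z : CSpace => (WithLp.toLp 2 fun i => (z i).re : Space) := by fun_prop
  exact hc.comp_aestronglyMeasurable h.1

theorem memLp_of_sobolevNorm_lt_top {s : ℝ} {f : Space → Space}
    (h : sobolevNorm s f < ∞) : MemLp f 2 volume :=
  memLp_of_complexify (memLp_complexify_of_sobolevNorm_lt_top h)

theorem eLpNorm_le_sobolevNorm {s : ℝ} (hs : 0 ≤ s) (f : Space → Space) :
    eLpNorm f 2 volume ≤ sobolevNorm s f := by
  by_cases h : MemLp (complexify f) 2 volume
  · have h1 : eLpNorm f 2 volume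
        = eLpNorm (𝓕 (h.toLp (complexify f)) : Lp CSpace 2 volume) 2 volume := by
      rw [← eLpNorm_complexify, ← eLpNorm_congr_ae h.coeFn_toLp, ← Lp.enorm_def, ← Lp.enorm_def,
        ← ofReal_norm, ← ofReal_norm, Lp.norm_fourier_eq]
    simp only [sobolevNorm, h, dif_pos]
    rw [h1]
    apply eLpNorm_mono
    intro ξ
    rw [norm_smul, Real.norm_of_nonneg (by positivity)]
    apply le_mul_of_one_le_left (norm_nonneg _)
    exact Real.one_le_rpow (by nlinarith [sq_nonneg ‖ξ‖]) (by linarith)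
  · simp [sobolevNorm, h]

/-- The inverse Fourier transform on `L²` is given by the Fourier integral where that converges. -/
theorem fourierInv_coeFn_ae_eq {g : Lp CSpace 2 (volume : Measure Space)}
    (hg : Integrable g) :
    (𝓕⁻ g : Lp CSpace 2 (volume : Measure Space)) =ᵐ[volume] 𝓕⁻ (g : Space → CSpace) := by
  have hcont : Continuous (𝓕⁻ (g : Space → CSpace)) := by
    rw [Real.fourierInv_eq_fourier_comp_neg]
    exact VectorFourier.fourierIntegral_continuous Real.continuous_fourierChar
      (by simp only [innerₗ_apply_apply]; fun_prop) hg.comp_neg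
  apply ae_eq_of_integral_contDiff_smul_eq
  · exact (Lp.memLp _).locallyIntegrable (by norm_num)
  · exact hcont.locallyIntegrable
  intro φ hφ hφs
  have hsupp : HasCompactSupport fun x => (φ x : ℂ) := hφs.comp_left Complex.ofReal_zero
  set Φ : SchwartzMap Space ℂ :=
    hsupp.toSchwartzMap (Complex.ofRealCLM.contDiff.comp hφ) with hΦ
  have hΦc : ∀ x, Φ x = (φ x : ℂ) := fun x => rfl
  have h1 := congrArg (fun S => S Φ) (Lp.fourierInv_toTemperedDistribution_eq g)
  simp only [TemperedDistribution.fourierInv_apply, Lp.toTemperedDistribution_apply] at h1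
  -- The sign in `-innerₗ` makes this the inverse transform; the identity moves it from the test
  -- function to `g`.
  have h2 := VectorFourier.integral_fourierIntegral_smul_eq_flip (e := Real.fourierChar)
    (μ := (volume : Measure Space)) (ν := (volume : Measure Space)) (L := -innerₗ Space)
    (f := (Φ : Space → ℂ)) (g := (g : Space → CSpace)) Real.continuous_fourierChar
    (by simp only [LinearMap.neg_apply, innerₗ_apply_apply]; fun_prop) Φ.integrable hg
  have h3 : (-innerₗ Space).flip = -innerₗ Space := by
    ext x y; simp [real_inner_comm]
  rw [h3] at h2
  have h4 : ∀ F : Space → CSpace, ∫ x, φ x • F x = ∫ x, Φ x • F x := by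
    intro F
    simp only [hΦc, Complex.coe_smul]
  rw [h4, h4, ← h1, SchwartzMap.fourierInv_coe]
  exact h2

/-- By Cauchy–Schwarz `(1 + |ξ|²)^(1/2) |f̂|` is integrable, being the product of `(1 +
|ξ|²)^((1-s)/2)` and the `L²` function `(1 + |ξ|²)^(s/2) |f̂|`. The inverse Fourier integral then
has a bounded derivative. -/
theorem exists_lipschitz_of_sobolevNorm_lt_top {s : ℝ} (hs : 5 / 2 < s) {f : Space → Space}
    (hf : Continuous f) (h : sobolevNorm s f < ∞) :
    ∃ M : ℝ, 0 ≤ M ∧ ∀ x y, ‖f x - f y‖ ≤ M * ‖x - y‖ := by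
  have hm := memLp_complexify_of_sobolevNorm_lt_top h
  set g : Lp CSpace 2 (volume : Measure Space) := 𝓕 (hm.toLp (complexify f)) with hgdef
  have hgw : MemLp (fun ξ : Space => ((1 + ‖ξ‖ ^ 2) ^ (s / 2) : ℝ) • g ξ) 2 volume := by
    have hc : Continuous (fun ξ : Space => ((1 + ‖ξ‖ ^ 2) ^ (s / 2) : ℝ)) :=
      Continuous.rpow_const (by fun_prop) fun ξ => Or.inl (by positivity)
    refine ⟨hc.aestronglyMeasurable.smul (Lp.aestronglyMeasurable g), ?_⟩
    · simpa only [sobolevNorm, hm, dif_pos] using h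
  have hw : MemLp (fun ξ : Space => ((1 + ‖ξ‖ ^ 2) ^ ((1 - s) / 2) : ℝ)) 2 volume := by
    have hc : Continuous (fun ξ : Space => ((1 + ‖ξ‖ ^ 2) ^ ((1 - s) / 2) : ℝ)) :=
      Continuous.rpow_const (by fun_prop) fun ξ => Or.inl (by positivity)
    rw [memLp_two_iff_integrable_sq hc.aestronglyMeasurable]
    -- The condition `2(s - 1) > 3` is exactly `s > 5/2`.
    have := integrable_rpow_neg_one_add_norm_sq (E := Space) (μ := (volume : Measure Space)) (r := 2 * (s - 1))
      (by simp; linarith)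
    refine this.congr (Eventually.of_forall fun ξ => ?_)
    simp only
    rw [← Real.rpow_mul_natCast (by positivity)]
    congr 1
    push_cast
    ring
  have hprod : Integrable fun ξ : Space => ((1 + ‖ξ‖ ^ 2) ^ (1 / 2 : ℝ) : ℝ) * ‖g ξ‖ := by
    have := hw.integrable_mul hgw.norm
    refine this.congr (Eventually.of_forall fun ξ => ?_)
    simp only [Pi.mul_apply, norm_smul]
    rw [Real.norm_of_nonneg (by positivity), ← mul_assoc, ← Real.rpow_add (by positivity)]
    congr 2
    ring
  have hone : ∀ ξ : Space, 1 ≤ ((1 + ‖ξ‖ ^ 2) ^ (1 / 2 : ℝ) : ℝ) := fun ξ =>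
    Real.one_le_rpow (by nlinarith [sq_nonneg ‖ξ‖]) (by norm_num)
  have hnorm : ∀ ξ : Space, ‖ξ‖ ≤ ((1 + ‖ξ‖ ^ 2) ^ (1 / 2 : ℝ) : ℝ) := fun ξ => by
    rw [← Real.sqrt_eq_rpow]
    exact Real.le_sqrt_of_sq_le (by linarith)
  have hgm := Lp.aestronglyMeasurable g
  have hint : Integrable g := hprod.mono' hgm
    (Eventually.of_forall fun ξ => le_mul_of_one_le_left (norm_nonneg _) (hone ξ))
  have hint1 : Integrable fun ξ : Space => ‖ξ‖ * ‖g ξ‖ := hprod.mono'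
    (continuous_norm.aestronglyMeasurable.mul hgm.norm) (Eventually.of_forall fun ξ => by
      rw [norm_mul, norm_norm, norm_norm]
      exact mul_le_mul_of_nonneg_right (hnorm ξ) (norm_nonneg _))
  set M := ∫ v, ‖VectorFourier.fourierSMulRight (innerSL ℝ) (g : Space → CSpace) v‖ with hM
  have hlip : ∀ x y, ‖𝓕 (g : Space → CSpace) x - 𝓕 (g : Space → CSpace) y‖ ≤ M * ‖x - y‖ := by
    intro x y
    refine convex_univ.norm_image_sub_le_of_norm_hasFDerivWithin_le
      (fun z _ => (Real.hasFDerivAt_fourier hint hint1 z).hasFDerivWithinAt) (fun z _ => ?_)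
      (mem_univ y) (mem_univ x)
    exact VectorFourier.norm_fourierIntegral_le_integral_norm _ _ _ _ _
  refine ⟨M, integral_nonneg fun _ => norm_nonneg _, fun x y => ?_⟩
  have hae : complexify f =ᵐ[volume] 𝓕⁻ (g : Space → CSpace) := by
    have h1 : 𝓕⁻ g = hm.toLp (complexify f) := by rw [hgdef, FourierTransform.fourierInv_fourier_eq]
    have h2 := fourierInv_coeFn_ae_eq hint
    rw [h1] at h2
    exact hm.coeFn_toLp.symm.trans h2
  have hcF : Continuous (𝓕⁻ (g : Space → CSpace)) := by
    have : 𝓕⁻ (g : Space → CSpace) = fun x => 𝓕 (g : Space → CSpace) (-x) :=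
      funext (Real.fourierInv_eq_fourier_neg _)
    rw [this]
    exact (Real.differentiable_fourier hint hint1).continuous.comp continuous_neg
  have hcf : Continuous (complexify f) := by unfold complexify; fun_prop
  have heq : complexify f = 𝓕⁻ (g : Space → CSpace) :=
    (Continuous.ae_eq_iff_eq volume hcf hcF).1 hae
  rw [← complexify_sub, heq, Real.fourierInv_eq_fourier_neg, Real.fourierInv_eq_fourier_neg]
  refine (hlip _ _).trans_eq ?_
  rw [neg_sub_neg, norm_sub_rev]

/-! ### Orthogonality of solenoidal fields and gradients. -/

theorem enorm_sub_le_lintegral_enorm_fderiv {H : Space → ℝ} (hH : ContDiff ℝ 1 H) (x y : Space) :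
    ‖H x - H y‖ₑ ≤ ‖x - y‖ₑ * ∫⁻ s in Icc (0 : ℝ) 1, ‖fderiv ℝ H (y + s • (x - y))‖ₑ := by
  have hc : Continuous fun s : ℝ => fderiv ℝ H (y + s • (x - y)) :=
    (hH.continuous_fderiv (by simp)).comp (by fun_prop)
  have hd : ∀ s : ℝ, HasDerivAt (fun s : ℝ => H (y + s • (x - y)))
      (fderiv ℝ H (y + s • (x - y)) (x - y)) s := by
    intro s
    have h2 : HasDerivAt (fun s : ℝ => y + s • (x - y)) (x - y) s := by
      simpa using ((hasDerivAt_id s).smul_const (x - y)).const_add y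
    exact (hH.differentiable (by simp) _).hasFDerivAt.comp_hasDerivAt s h2
  have hcd : Continuous fun s : ℝ => fderiv ℝ H (y + s • (x - y)) (x - y) :=
    hc.clm_apply continuous_const
  have hftc := intervalIntegral.integral_eq_sub_of_hasDerivAt (a := 0) (b := 1)
    (fun s _ => hd s) (hcd.intervalIntegrable 0 1)
  have e : H x - H y = ∫ s in Icc (0 : ℝ) 1, fderiv ℝ H (y + s • (x - y)) (x - y) := by
    rw [integral_Icc_eq_integral_Ioc, ← intervalIntegral.integral_of_le zero_le_one, hftc]
    simp
  rw [e]
  refine (enorm_integral_le_lintegral_enorm _).trans ?_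
  rw [← lintegral_const_mul _ hc.enorm.measurable]
  refine lintegral_mono fun s => ?_
  rw [mul_comm]
  exact ContinuousLinearMap.le_opENorm _ _

theorem lintegral_comp_add_smul_le {F : Space → ℝ≥0∞} (hF : Measurable F) (y : Space) {s : ℝ}
    (hs : 1 / 2 ≤ s) : ∫⁻ x, F (y + s • x) ≤ 8 * ∫⁻ x, F x := by
  have hs0 : s ≠ 0 := by linarith
  have h1 : ∫⁻ x, F (y + s • x) = ∫⁻ x, F (y + x) ∂(Measure.map (s • ·) volume) := by
    rw [lintegral_map (f := fun x => F (y + x)) (hF.comp (measurable_const_add y))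
      (measurable_const_smul s)]
  rw [h1, Measure.map_addHaar_smul _ hs0, lintegral_smul_measure,
    lintegral_add_left_eq_self F y, smul_eq_mul]
  gcongr
  rw [finrank_euclideanSpace_fin, abs_of_nonneg (by positivity)]
  have : (s ^ 3)⁻¹ ≤ 8 := by
    rw [inv_le_comm₀ (by positivity) (by norm_num)]
    calc (8 : ℝ)⁻¹ = (1 / 2) ^ 3 := by norm_num
      _ ≤ s ^ 3 := by gcongr
  calc ENNReal.ofReal (s ^ 3)⁻¹ ≤ ENNReal.ofReal 8 := ENNReal.ofReal_le_ofReal this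
    _ = 8 := by simp

/-- For `s ≥ 1/2` the substitution in `x` has Jacobian factor `s⁻³ ≤ 8`; for `s ≤ 1/2` the roles of
`x` and `y` are exchanged. -/
theorem lintegral_lintegral_segment_le {F : Space → ℝ≥0∞} (hF : Measurable F) (B : Set Space)
    {s : ℝ} :
    ∫⁻ y in B, ∫⁻ x in B, F (y + s • (x - y)) ≤ 8 * volume B * ∫⁻ x, F x := by
  have key : ∀ s : ℝ, 1 / 2 ≤ s →
      ∫⁻ y in B, ∫⁻ x in B, F (y + s • (x - y)) ≤ 8 * volume B * ∫⁻ x, F x := by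
    intro s hs
    calc ∫⁻ y in B, ∫⁻ x in B, F (y + s • (x - y))
        ≤ ∫⁻ _ in B, 8 * ∫⁻ x, F x := by
          refine lintegral_mono fun y => ?_
          refine (setLIntegral_le_lintegral _ _).trans ?_
          refine le_trans (le_of_eq ?_) (lintegral_comp_add_smul_le hF (y - s • y) hs)
          congr 1; ext x; congr 1
          rw [smul_sub]; abel
      _ = _ := by rw [setLIntegral_const]; ring
  rcases le_total (1 / 2) s with hs | hs
  · exact key s hs
  · have hm : Measurable fun p : Space × Space => F (p.1 + s • (p.2 - p.1)) :=
      hF.comp (by fun_prop)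
    rw [lintegral_lintegral_swap hm.aemeasurable]
    refine le_trans (le_of_eq ?_) (key (1 - s) (by linarith))
    congr 1; ext y; congr 1; ext x; congr 1
    rw [sub_smul, one_smul, smul_sub, smul_sub]; abel

/-- A weighted Poincaré inequality on balls, with the mean value replaced by double integration. -/
theorem lintegral_lintegral_enorm_sub_mul_le {H : Space → ℝ} (hH : ContDiff ℝ 1 H)
    {a : Space → ℝ≥0∞} (ha : Measurable a) {r : ℝ} :
    ∫⁻ y in Metric.ball 0 r, ∫⁻ x in Metric.ball 0 r, ‖H x - H y‖ₑ * a x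
      ≤ ENNReal.ofReal (2 * r) * (volume (Metric.ball (0 : Space) r) *
        ((8 * ∫⁻ x, ‖fderiv ℝ H x‖ₑ ^ (2 : ℝ)) ^ (1 / 2 : ℝ)
          * (∫⁻ x, a x ^ (2 : ℝ)) ^ (1 / 2 : ℝ))) := by
  set B := Metric.ball (0 : Space) r with hB
  set F : Space → ℝ≥0∞ := fun x => ‖fderiv ℝ H x‖ₑ with hFdef
  have hF : Measurable F := (hH.continuous_fderiv (by simp)).enorm.measurable
  have hmeas3 : Measurable fun p : (Space × Space) × ℝ =>
      F (p.1.1 + p.2 • (p.1.2 - p.1.1)) * a p.1.2 :=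
    (hF.comp (by fun_prop)).mul (ha.comp (by fun_prop))
  calc ∫⁻ y in B, ∫⁻ x in B, ‖H x - H y‖ₑ * a x
      ≤ ∫⁻ y in B, ∫⁻ x in B, ENNReal.ofReal (2 * r) *
          ∫⁻ s in Icc (0 : ℝ) 1, F (y + s • (x - y)) * a x := by
        refine setLIntegral_mono' measurableSet_ball fun y hy => ?_
        refine setLIntegral_mono' measurableSet_ball fun x hx => ?_
        have hms : Measurable fun s : ℝ => F (y + s • (x - y)) := hF.comp (by fun_prop)
        rw [lintegral_mul_const _ hms, ← mul_assoc]
        gcongr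
        refine (enorm_sub_le_lintegral_enorm_fderiv hH x y).trans ?_
        gcongr
        rw [← ofReal_norm]
        apply ENNReal.ofReal_le_ofReal
        have hx' : ‖x‖ < r := by simpa [hB] using hx
        have hy' : ‖y‖ < r := by simpa [hB] using hy
        linarith [norm_sub_le x y]
    _ = ENNReal.ofReal (2 * r) * ∫⁻ p : Space × Space, (∫⁻ s in Icc (0 : ℝ) 1,
          F (p.1 + s • (p.2 - p.1)) * a p.2)
            ∂((volume.restrict B).prod (volume.restrict B)) := by
        rw [lintegral_prod _ (hmeas3.lintegral_prod_right').aemeasurable,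
          ← lintegral_const_mul _ hmeas3.lintegral_prod_right'.lintegral_prod_right']
        congr 1; ext y
        rw [← lintegral_const_mul]
        exact hmeas3.lintegral_prod_right'.comp measurable_prodMk_left
    _ = ENNReal.ofReal (2 * r) * ∫⁻ s in Icc (0 : ℝ) 1, (∫⁻ p : Space × Space,
          F (p.1 + s • (p.2 - p.1)) * a p.2
            ∂((volume.restrict B).prod (volume.restrict B))) := by
        rw [lintegral_lintegral_swap hmeas3.aemeasurable]
    _ ≤ ENNReal.ofReal (2 * r) * ∫⁻ s in Icc (0 : ℝ) 1, volume B *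
          ((8 * ∫⁻ x, F x ^ (2 : ℝ)) ^ (1 / 2 : ℝ) * (∫⁻ x, a x ^ (2 : ℝ)) ^ (1 / 2 : ℝ)) := by
        gcongr with s
        have hm1 : Measurable fun p : Space × Space => F (p.1 + s • (p.2 - p.1)) :=
          hF.comp (by fun_prop)
        have hm2 : Measurable fun p : Space × Space => a p.2 := ha.comp measurable_snd
        -- Cauchy–Schwarz on `B × B` at fixed `s`; each factor contributes `(volume B)^(1/2)`.
        refine (ENNReal.lintegral_mul_le_Lp_mul_Lq _ Real.HolderConjugate.two_two
          hm1.aemeasurable hm2.aemeasurable).trans ?_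
        have i1 : ∫⁻ p, F (p.1 + s • (p.2 - p.1)) ^ (2 : ℝ)
            ∂((volume.restrict B).prod (volume.restrict B))
              ≤ volume B * (8 * ∫⁻ x, F x ^ (2 : ℝ)) := by
          rw [lintegral_prod _ (hm1.pow_const _).aemeasurable]
          refine (lintegral_lintegral_segment_le (hF.pow_const (2 : ℝ)) B).trans_eq ?_
          ring
        have i2 : ∫⁻ p, a p.2 ^ (2 : ℝ) ∂((volume.restrict B).prod (volume.restrict B))
              ≤ volume B * ∫⁻ x, a x ^ (2 : ℝ) := by
          rw [lintegral_prod _ (hm2.pow_const _).aemeasurable]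
          simp only [lintegral_const, Measure.restrict_apply_univ]
          rw [mul_comm]
          gcongr
          exact Measure.restrict_le_self
        calc _ ≤ (volume B * (8 * ∫⁻ x, F x ^ (2 : ℝ))) ^ (1 / 2 : ℝ)
              * (volume B * ∫⁻ x, a x ^ (2 : ℝ)) ^ (1 / 2 : ℝ) := by gcongr
          _ = _ := by
            rw [ENNReal.mul_rpow_of_nonneg _ _ (by norm_num),
              ENNReal.mul_rpow_of_nonneg (volume B) _ (by norm_num), mul_mul_mul_comm,
              ← ENNReal.rpow_add_of_nonneg _ _ (by norm_num) (by norm_num)]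
            norm_num
    _ = _ := by simp [hFdef]

/-- Since `div u = 0`, `∇H · u = div((H - c) u)`. The free constant `c` is what permits a Poincaré
argument for an `H` without decay. -/
theorem integral_cutoff_mul_fderiv {u : Space → Space} (hu : ContDiff ℝ 1 u)
    (hdiv : ∀ x, divergence u x = 0) {H : Space → ℝ} (hH : ContDiff ℝ 1 H)
    {χ : Space → ℝ} (hχ : ContDiff ℝ 1 χ) (hχs : HasCompactSupport χ) (c : ℝ) :
    ∫ x, χ x * fderiv ℝ H x (u x) = -∫ x, (H x - c) * fderiv ℝ χ x (u x) := by
  have huc := contDiff_component hu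
  have hHc : ContDiff ℝ 1 fun x => H x - c := hH.sub contDiff_const
  have hpd : ∀ i x, partialDeriv i (fun x => H x - c) x = partialDeriv i H x := by
    intro i x; unfold partialDeriv; rw [fderiv_sub_const]
  have hg : ∀ i, ContDiff ℝ 1 fun x => χ x * u x i := fun i => hχ.mul (huc i)
  have hgs : ∀ i, HasCompactSupport fun x => χ x * u x i := fun i => hχs.mul_right
  have hibp := fun i => integral_partialDeriv_mul (hg i) (hgs i) hHc i
  simp only [hpd] at hibp
  have hprod : ∀ i x, partialDeriv i (fun x => χ x * u x i) x
      = partialDeriv i χ x * u x i + χ x * partialDeriv i (fun x => u x i) x := by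
    intro i x
    unfold partialDeriv
    rw [fderiv_fun_mul (hχ.differentiable (by simp) x) ((huc i).differentiable (by simp) x)]
    simp
    ring
  have hl : ∫ x, χ x * fderiv ℝ H x (u x) = ∑ i, ∫ x, χ x * u x i * partialDeriv i H x := by
    rw [← integral_finsetSum _ fun i _ => integrable_mul_of_hasCompactSupport (hg i).continuous
      (hgs i) (continuous_partialDeriv hH i)]
    congr 1; ext x
    rw [fderiv_eq_sum_partialDeriv, Finset.mul_sum]
    simp only [mul_assoc]
  have hr : ∫ x, (H x - c) * fderiv ℝ χ x (u x)
      = ∑ i, ∫ x, partialDeriv i (fun x => χ x * u x i) x * (H x - c) := by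
    rw [← integral_finsetSum _ fun i _ => integrable_mul_of_hasCompactSupport
      (continuous_partialDeriv (hg i) i) (hasCompactSupport_partialDeriv (hgs i) i) hHc.continuous]
    congr 1; ext x
    have hd := hdiv x
    simp only [divergence, velGrad_eq_partialDeriv hu] at hd
    simp only [hprod]
    rw [← Finset.sum_mul, Finset.sum_add_distrib, ← Finset.mul_sum, hd, fderiv_eq_sum_partialDeriv]
    simp only [mul_comm (u x _)]
    ring
  rw [hl, hr]
  simp only [hibp, Finset.sum_neg_distrib, neg_neg]

theorem exists_cutoff : ∃ M : ℝ, 0 ≤ M ∧ ∀ r : ℝ, 0 < r → ∃ χ : Space → ℝ,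
    ContDiff ℝ 1 χ ∧ HasCompactSupport χ ∧ (∀ x, |χ x| ≤ 1) ∧ (∀ x, ‖x‖ ≤ r → χ x = 1) ∧
    (∀ x, ‖fderiv ℝ χ x‖ ≤ M / r) ∧ (∀ x, ‖x‖ < r → fderiv ℝ χ x = 0) ∧
    ∀ x, 2 * r ≤ ‖x‖ → fderiv ℝ χ x = 0 := by
  -- Outer radius `3/2` rather than `2`, so that the dilated bump vanishes near every point with `2
  -- * r ≤ ‖x‖`.
  let b : ContDiffBump (0 : Space) := ⟨1, 3 / 2, one_pos, by norm_num⟩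
  have hb : ContDiff ℝ 1 b := b.contDiff
  obtain ⟨M, hM⟩ := (b.hasCompactSupport.fderiv (𝕜 := ℝ)).exists_bound_of_continuous
    (hb.continuous_fderiv (by simp))
  refine ⟨M, (norm_nonneg _).trans (hM 0), fun r hr => ?_⟩
  have hnorm : ∀ x : Space, ‖r⁻¹ • x‖ = ‖x‖ / r := fun x => by
    rw [norm_smul, norm_inv, Real.norm_of_nonneg hr.le, inv_mul_eq_div]
  have hout : ∀ x : Space, 3 / 2 * r ≤ ‖x‖ → b (r⁻¹ • x) = 0 := fun x hx =>
    b.zero_of_le_dist (by rw [dist_zero_right, hnorm, le_div_iff₀ hr]; exact hx)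
  have hin : ∀ x : Space, ‖x‖ ≤ r → b (r⁻¹ • x) = 1 := fun x hx =>
    b.one_of_mem_closedBall (by
      rw [mem_closedBall_zero_iff, hnorm]; exact (div_le_one hr).2 hx)
  refine ⟨fun x => b (r⁻¹ • x), hb.comp (contDiff_const_smul _), ?_, ?_, hin, ?_, ?_, ?_⟩
  · apply HasCompactSupport.intro (isCompact_closedBall (0 : Space) (3 / 2 * r))
    intro x hx
    exact hout x (by simpa using (not_le.1 (by simpa using hx)).le)
  · intro x
    rw [abs_of_nonneg b.nonneg]
    exact b.le_one
  · intro x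
    have h1 : HasFDerivAt b (fderiv ℝ b (r⁻¹ • x)) (r⁻¹ • x) :=
      (hb.differentiable (by simp) _).hasFDerivAt
    have h2 : HasFDerivAt (fun x : Space => r⁻¹ • x) (r⁻¹ • ContinuousLinearMap.id ℝ Space) x :=
      (hasFDerivAt_id x).const_smul r⁻¹
    have h3 := h1.comp x h2
    rw [show (fun x : Space => b (r⁻¹ • x)) = b ∘ fun x => r⁻¹ • x from rfl, h3.fderiv,
      ContinuousLinearMap.comp_smul, ContinuousLinearMap.comp_id, norm_smul, norm_inv,
      Real.norm_of_nonneg hr.le, inv_mul_eq_div]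
    gcongr
    exact hM _
  · intro x hx
    have : (fun x : Space => b (r⁻¹ • x)) =ᶠ[𝓝 x] fun _ => 1 := by
      filter_upwards [(isOpen_lt continuous_norm continuous_const).mem_nhds hx] with z hz
      exact hin z (le_of_lt hz)
    rw [this.fderiv_eq]; simp
  · intro x hx
    have : (fun x : Space => b (r⁻¹ • x)) =ᶠ[𝓝 x] fun _ => 0 := by
      filter_upwards [(isOpen_lt continuous_const continuous_norm).mem_nhds
        (show 3 / 2 * r < ‖x‖ by linarith)] with z hz
      exact hout z (le_of_lt hz)
    rw [this.fderiv_eq]; simp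

/-- The factor `1/r` from the cutoff cancels the radius in the Poincaré inequality. The bound
depends on `r` only through the tail of `u` outside radius `r`, which tends to zero in `L²`. -/
theorem enorm_integral_cutoff_mul_fderiv_le {u : Space → Space} (hu : ContDiff ℝ 1 u)
    (hdiv : ∀ x, divergence u x = 0) {H : Space → ℝ} (hH : ContDiff ℝ 1 H)
    {χ : Space → ℝ} (hχ : ContDiff ℝ 1 χ) (hχs : HasCompactSupport χ) {M r : ℝ} (hM : 0 ≤ M)
    (hr : 0 < r) (hbound : ∀ x, ‖fderiv ℝ χ x‖ ≤ M / r)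
    (hin : ∀ x, ‖x‖ < r → fderiv ℝ χ x = 0) (hout : ∀ x, 2 * r ≤ ‖x‖ → fderiv ℝ χ x = 0) :
    ‖∫ x, χ x * fderiv ℝ H x (u x)‖ₑ ≤ ENNReal.ofReal (4 * M) *
      ((8 * ∫⁻ x, ‖fderiv ℝ H x‖ₑ ^ (2 : ℝ)) ^ (1 / 2 : ℝ) *
        (∫⁻ x, {x : Space | r ≤ ‖x‖}.indicator (fun x => ‖u x‖ₑ) x ^ (2 : ℝ)) ^ (1 / 2 : ℝ)) := by
  set a : Space → ℝ≥0∞ := {x : Space | r ≤ ‖x‖}.indicator fun x => ‖u x‖ₑ with ha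
  set B := Metric.ball (0 : Space) (2 * r) with hB
  have ham : Measurable a := hu.continuous.enorm.measurable.indicator
    (isClosed_le continuous_const continuous_norm).measurableSet
  have hy : ∀ y, ‖∫ x, χ x * fderiv ℝ H x (u x)‖ₑ
      ≤ ENNReal.ofReal (M / r) * ∫⁻ x in B, ‖H x - H y‖ₑ * a x := by
    intro y
    rw [integral_cutoff_mul_fderiv hu hdiv hH hχ hχs (H y), enorm_neg]
    refine (enorm_integral_le_lintegral_enorm _).trans ?_
    have hm : Measurable fun x => ‖H x - H y‖ₑ * a x :=
      (hH.continuous.sub continuous_const).enorm.measurable.mul ham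
    rw [← lintegral_const_mul _ hm, ← lintegral_indicator measurableSet_ball]
    refine lintegral_mono fun x => ?_
    by_cases h1 : ‖x‖ < r
    · simp [hin x h1]
    by_cases h2 : 2 * r ≤ ‖x‖
    · simp [hout x h2]
    have hxB : x ∈ B := by simpa [hB] using h2
    have hax : a x = ‖u x‖ₑ := 
      indicator_of_mem (s := {x : Space | r ≤ ‖x‖}) (not_lt.1 h1) _
    rw [indicator_of_mem hxB, hax, enorm_mul, mul_left_comm]
    gcongr
    refine (ContinuousLinearMap.le_opENorm _ _).trans ?_
    gcongr
    rw [← ofReal_norm]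
    exact ENNReal.ofReal_le_ofReal (hbound x)
  have hBpos : volume B ≠ 0 := (Metric.measure_ball_pos _ _ (by linarith)).ne'
  have hBfin : volume B ≠ ∞ := measure_ball_lt_top.ne
  -- The left side does not depend on `y`, so the constant `c = H y` is averaged over `y ∈ B`.
  have hmul : volume B * ‖∫ x, χ x * fderiv ℝ H x (u x)‖ₑ ≤ volume B * (ENNReal.ofReal (4 * M) *
      ((8 * ∫⁻ x, ‖fderiv ℝ H x‖ₑ ^ (2 : ℝ)) ^ (1 / 2 : ℝ) *
        (∫⁻ x, a x ^ (2 : ℝ)) ^ (1 / 2 : ℝ))) := by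
    calc volume B * ‖∫ x, χ x * fderiv ℝ H x (u x)‖ₑ
        = ∫⁻ _ in B, ‖∫ x, χ x * fderiv ℝ H x (u x)‖ₑ := by rw [setLIntegral_const, mul_comm]
      _ ≤ ∫⁻ y in B, ENNReal.ofReal (M / r) * ∫⁻ x in B, ‖H x - H y‖ₑ * a x :=
          lintegral_mono hy
      _ = ENNReal.ofReal (M / r) * ∫⁻ y in B, ∫⁻ x in B, ‖H x - H y‖ₑ * a x :=
          lintegral_const_mul' _ _ ENNReal.ofReal_ne_top
      _ ≤ ENNReal.ofReal (M / r) * (ENNReal.ofReal (2 * (2 * r)) * (volume B *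
            ((8 * ∫⁻ x, ‖fderiv ℝ H x‖ₑ ^ (2 : ℝ)) ^ (1 / 2 : ℝ)
              * (∫⁻ x, a x ^ (2 : ℝ)) ^ (1 / 2 : ℝ)))) := by
          gcongr
          exact lintegral_lintegral_enorm_sub_mul_le hH ham
      _ = _ := by
          rw [← mul_assoc, ← ENNReal.ofReal_mul (by positivity),
            show M / r * (2 * (2 * r)) = 4 * M by field_simp; ring, mul_left_comm]
  exact (ENNReal.mul_le_mul_iff_right hBpos hBfin).1 hmul

/-- A solenoidal `L²` field is orthogonal to every gradient in `L²`. -/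
theorem integral_fderiv_apply_eq_zero {u : Space → Space} (hu : ContDiff ℝ 1 u)
    (hu2 : MemLp u 2) (hdiv : ∀ x, divergence u x = 0) {H : Space → ℝ} (hH : ContDiff ℝ 1 H)
    (hH2 : MemLp (fderiv ℝ H) 2) : ∫ x, fderiv ℝ H x (u x) = 0 := by
  obtain ⟨M, hM, hcut⟩ := exists_cutoff
  have hpos : ∀ n : ℕ, (0 : ℝ) < n + 1 := fun n => by positivity
  choose χ hχ hχs hχ1 hχin hχb hχz hχo using fun n : ℕ => hcut (n + 1) (hpos n)
  have hfin : ∀ {E : Type} [NormedAddCommGroup E] {f : Space → E}, MemLp f 2 volume →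
      ∫⁻ x, ‖f x‖ₑ ^ (2 : ℝ) ≠ ∞ := by
    intro E _ f hf
    have := hf.eLpNorm_lt_top
    rw [eLpNorm_lt_top_iff_lintegral_rpow_enorm_lt_top (by norm_num) (by norm_num)] at this
    simpa using this.ne
  have hcD : Continuous (fderiv ℝ H) := hH.continuous_fderiv (by simp)
  have hcI : Continuous fun x => fderiv ℝ H x (u x) := hcD.clm_apply hu.continuous
  have hdom : Integrable fun x => ‖fderiv ℝ H x‖ * ‖u x‖ := hH2.norm.integrable_mul hu2.norm
  have hlim1 : Tendsto (fun n => ∫ x, χ n x * fderiv ℝ H x (u x)) atTop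
      (𝓝 (∫ x, fderiv ℝ H x (u x))) := by
    refine tendsto_integral_of_dominated_convergence (fun x => ‖fderiv ℝ H x‖ * ‖u x‖)
      (fun n => ((hχ n).continuous.mul hcI).aestronglyMeasurable) hdom ?_ ?_
    · intro n
      filter_upwards with x
      rw [norm_mul]
      refine (mul_le_of_le_one_left (norm_nonneg _) (hχ1 n x)).trans ?_
      exact ContinuousLinearMap.le_opNorm _ _
    · filter_upwards with x
      refine tendsto_const_nhds.congr' ?_
      filter_upwards [eventually_ge_atTop ⌈‖x‖⌉₊] with n hn
      rw [hχin n x ((Nat.ceil_le.1 hn).trans (by linarith)), one_mul]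
  have hlim2 : Tendsto (fun n : ℕ => ∫⁻ x, {x : Space | (n + 1 : ℝ) ≤ ‖x‖}.indicator
      (fun x => ‖u x‖ₑ) x ^ (2 : ℝ)) atTop (𝓝 0) := by
    have h0 : ∫⁻ _ : Space, (0 : ℝ≥0∞) = 0 := by simp
    rw [← h0]
    refine tendsto_lintegral_of_dominated_convergence (fun x => ‖u x‖ₑ ^ (2 : ℝ)) ?_ ?_
      (hfin hu2) ?_
    · intro n
      exact (hu.continuous.enorm.measurable.indicator
        (isClosed_le continuous_const continuous_norm).measurableSet).pow_const _
    · intro n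
      filter_upwards with x
      gcongr
      exact indicator_le_self _ _ x
    · filter_upwards with x
      refine tendsto_const_nhds.congr' ?_
      filter_upwards [eventually_ge_atTop ⌈‖x‖⌉₊] with n hn
      have : x ∉ {x : Space | (n + 1 : ℝ) ≤ ‖x‖} := by
        simp only [mem_ofPred_eq, not_le]
        linarith [Nat.ceil_le.1 hn]
      rw [indicator_of_notMem this]
      simp
  have hK : (8 * ∫⁻ x, ‖fderiv ℝ H x‖ₑ ^ (2 : ℝ)) ^ (1 / 2 : ℝ) ≠ ∞ :=
    ENNReal.rpow_ne_top_of_nonneg (by norm_num) (ENNReal.mul_ne_top (by norm_num) (hfin hH2))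
  have hlim3 : Tendsto (fun n : ℕ => ENNReal.ofReal (4 * M) *
      ((8 * ∫⁻ x, ‖fderiv ℝ H x‖ₑ ^ (2 : ℝ)) ^ (1 / 2 : ℝ) *
        (∫⁻ x, {x : Space | (n + 1 : ℝ) ≤ ‖x‖}.indicator (fun x => ‖u x‖ₑ) x ^ (2 : ℝ))
          ^ (1 / 2 : ℝ))) atTop (𝓝 0) := by
    have h1 := (ENNReal.continuous_rpow_const (y := 1 / 2)).tendsto (0 : ℝ≥0∞) |>.comp hlim2
    rw [ENNReal.zero_rpow_of_pos (by norm_num)] at h1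
    have h2 := ENNReal.Tendsto.const_mul (b := 0) h1 (Or.inr hK)
    have h3 := ENNReal.Tendsto.const_mul h2 (Or.inr (ENNReal.ofReal_ne_top (r := 4 * M)))
    simpa using h3
  have hlim4 : Tendsto (fun n => ‖∫ x, χ n x * fderiv ℝ H x (u x)‖ₑ) atTop (𝓝 0) :=
    tendsto_of_tendsto_of_tendsto_of_le_of_le tendsto_const_nhds hlim3 (fun _ => zero_le)
      fun n => enorm_integral_cutoff_mul_fderiv_le hu hdiv hH (hχ n) (hχs n) hM (hpos n) (hχb n)
        (hχz n) (hχo n)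
  exact enorm_eq_zero.1 (tendsto_nhds_unique hlim1.enorm hlim4)

/-! ### Conservation of energy. -/

theorem integral_inner_timeDeriv_eq_zero {s T : ℝ} {u : ℝ → Space → Space} {p : ℝ → Space → ℝ}
    {u₀ : Space → Space} (hs : 5 / 2 < s) (h : IsSolution s T u p u₀) {t : ℝ}
    (ht : t ∈ Icc 0 T) : ∫ x, inner ℝ (u t x) (timeDeriv T u t x) = 0 := by
  have hu := h.velocity_space t ht
  have hp := h.pressure_space t ht
  have hu2 : MemLp (u t) 2 := memLp_of_sobolevNorm_lt_top (h.mem_class t ht).1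
  have hw2 : MemLp (timeDeriv T u t) 2 :=
    memLp_of_sobolevNorm_lt_top (h.time_derivative_mem_class t ht).1
  obtain ⟨M, hM, hlip⟩ :=
    exists_lipschitz_of_sobolevNorm_lt_top hs hu.continuous (h.mem_class t ht).1
  have hDu : ∀ x, ‖fderiv ℝ (u t) x‖ ≤ M := fun x => by
    refine norm_fderiv_le_of_lip' ℝ hM (Eventually.of_forall fun y => hlip y x)
  -- The Bernoulli function: the convective term paired with `u` is the derivative of `|u|²/2` along
  -- `u`, so only the time derivative survives in `u · ∇H`.
  set H : Space → ℝ := fun x => 1 / 2 * ‖u t x‖ ^ 2 + p t x with hHdef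
  have hH : ContDiff ℝ 1 H := (contDiff_const.mul (hu.norm_sq ℝ)).add hp
  have hmom : ∀ x, gradient (p t) x = -timeDeriv T u t x - fderiv ℝ (u t) x (u t x) := fun x => by
    have := h.momentum t ht x
    rw [eq_sub_iff_add_eq, eq_neg_iff_add_eq_zero, ← this]
    abel
  have hfd : ∀ x v, fderiv ℝ H x v = inner ℝ (u t x) (fderiv ℝ (u t) x v)
      + inner ℝ (-timeDeriv T u t x - fderiv ℝ (u t) x (u t x)) v := by
    intro x v
    have h1 : HasFDerivAt (u t) (fderiv ℝ (u t) x) x :=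
      (hu.differentiable (by simp) x).hasFDerivAt
    have h2 : HasFDerivAt (p t) (fderiv ℝ (p t) x) x :=
      (hp.differentiable (by simp) x).hasFDerivAt
    have h3 := (h1.norm_sq.const_mul (1 / 2)).add h2
    have h4 : fderiv ℝ (p t) x v = inner ℝ (gradient (p t) x) v := by
      simp [gradient]
    rw [← hmom, ← h4, show H = (fun y => 1 / 2 * ‖u t y‖ ^ 2) + p t from rfl, h3.fderiv]
    simp
  have hnorm : ∀ x, ‖fderiv ℝ H x‖ ≤ 2 * M * ‖u t x‖ + ‖timeDeriv T u t x‖ := by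
    intro x
    refine ContinuousLinearMap.opNorm_le_bound _ (by positivity) fun v => ?_
    have b1 : ∀ v, ‖fderiv ℝ (u t) x v‖ ≤ M * ‖v‖ := fun v =>
      (ContinuousLinearMap.le_opNorm _ v).trans (by gcongr; exact hDu x)
    rw [hfd]
    calc _ ≤ ‖u t x‖ * (M * ‖v‖) + (‖timeDeriv T u t x‖ + M * ‖u t x‖) * ‖v‖ := by
          refine (norm_add_le _ _).trans (add_le_add ?_ ?_)
          · refine (norm_inner_le_norm _ _).trans ?_
            gcongr
            exact b1 v
          · refine (norm_inner_le_norm _ _).trans ?_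
            gcongr
            refine (norm_sub_le _ _).trans ?_
            rw [norm_neg]
            gcongr
            exact b1 _
      _ = _ := by ring
  have hH2 : MemLp (fderiv ℝ H) 2 := by
    have hg : MemLp (fun x => 2 * M * ‖u t x‖ + ‖timeDeriv T u t x‖) 2 :=
      (hu2.norm.const_mul (2 * M)).add hw2.norm
    refine hg.of_le (hH.continuous_fderiv (by simp)).aestronglyMeasurable
      (Eventually.of_forall fun x => ?_)
    rw [Real.norm_of_nonneg (by positivity)]
    exact hnorm x
  have hzero := integral_fderiv_apply_eq_zero hu hu2 (h.incompressible t ht) hH hH2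
  have hpt : ∀ x, fderiv ℝ H x (u t x) = -inner ℝ (u t x) (timeDeriv T u t x) := by
    intro x
    rw [hfd, inner_sub_left, inner_neg_left, real_inner_comm (u t x) (timeDeriv T u t x),
      real_inner_comm (u t x) (fderiv ℝ (u t) x (u t x))]
    ring
  simp only [hpt, integral_neg, neg_eq_zero] at hzero
  exact hzero

open Classical in
/-- The path `u`, with values in `L²`. -/
def lpPath (u : ℝ → Space → Space) (t : ℝ) : Lp Space 2 (volume : Measure Space) :=
  if h : MemLp (u t) 2 volume then h.toLp (u t) else 0

theorem hasDerivWithinAt_lpPath {s T : ℝ} {u : ℝ → Space → Space} {p : ℝ → Space → ℝ}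
    {u₀ : Space → Space} (hs : 5 / 2 < s) (h : IsSolution s T u p u₀) {t : ℝ}
    (ht : t ∈ Icc 0 T) (hw : MemLp (timeDeriv T u t) 2 volume) :
    HasDerivWithinAt (lpPath u) (hw.toLp (timeDeriv T u t)) (Icc 0 T) t := by
  have hmem : ∀ τ ∈ Icc 0 T, MemLp (u τ) 2 volume := fun τ hτ =>
    memLp_of_sobolevNorm_lt_top (h.mem_class τ hτ).1
  rw [hasDerivWithinAt_iff_tendsto_slope, tendsto_iff_norm_sub_tendsto_zero]
  have hlim := h.time_derivative t ht
  have hlim2 : Tendsto (fun τ => (eLpNorm ((τ - t)⁻¹ • (u τ - u t) - timeDeriv T u t) 2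
      volume).toReal) (𝓝[Icc 0 T \ {t}] t) (𝓝 0) := by
    have h1 := tendsto_of_tendsto_of_tendsto_of_le_of_le tendsto_const_nhds hlim
      (fun _ => zero_le) fun τ => eLpNorm_le_sobolevNorm (by linarith : 0 ≤ s - 1)
        ((τ - t)⁻¹ • (u τ - u t) - timeDeriv T u t)
    simpa [Function.comp_def] using (ENNReal.tendsto_toReal ENNReal.zero_ne_top).comp h1
  refine hlim2.congr' ?_
  filter_upwards [self_mem_nhdsWithin] with τ hτ
  have e : slope (lpPath u) t τ - hw.toLp (timeDeriv T u t)
      = ((((hmem τ hτ.1).sub (hmem t ht)).const_smul (τ - t)⁻¹).sub hw).toLp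
        ((τ - t)⁻¹ • (u τ - u t) - timeDeriv T u t) := by
    rw [slope_def_module, lpPath, lpPath, dif_pos (hmem τ hτ.1), dif_pos (hmem t ht)]
    rfl
  rw [e, Lp.norm_toLp]

/-- Conservation of energy. -/
theorem eLpNorm_eq_initial {s T : ℝ} {u : ℝ → Space → Space} {p : ℝ → Space → ℝ}
    {u₀ : Space → Space} (hs : 5 / 2 < s) (h : IsSolution s T u p u₀) {t : ℝ}
    (ht : t ∈ Icc 0 T) : eLpNorm (u t) 2 volume = eLpNorm u₀ 2 volume := by
  have hmem : ∀ τ ∈ Icc 0 T, MemLp (u τ) 2 volume := fun τ hτ =>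
    memLp_of_sobolevNorm_lt_top (h.mem_class τ hτ).1
  have hderiv : ∀ τ ∈ Icc 0 T,
      HasDerivWithinAt (fun τ => ‖lpPath u τ‖ ^ 2) 0 (Icc 0 T) τ := by
    intro τ hτ
    have hw : MemLp (timeDeriv T u τ) 2 volume :=
      memLp_of_sobolevNorm_lt_top (h.time_derivative_mem_class τ hτ).1
    refine (hasDerivWithinAt_lpPath hs h hτ hw).norm_sq.congr_deriv ?_
    rw [lpPath, dif_pos (hmem τ hτ), L2.inner_def, mul_eq_zero]
    right
    rw [← integral_inner_timeDeriv_eq_zero hs h hτ]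
    apply integral_congr_ae
    filter_upwards [(hmem τ hτ).coeFn_toLp, hw.coeFn_toLp] with x h1 h2
    rw [h1, h2]
  have hconst := constant_of_derivWithin_zero (fun τ hτ => (hderiv τ hτ).differentiableWithinAt)
    (fun τ hτ => (hderiv τ (Ico_subset_Icc_self hτ)).derivWithin
      (uniqueDiffOn_Icc (hτ.1.trans_lt hτ.2) τ (Ico_subset_Icc_self hτ))) t ht
  have h0 : (0 : ℝ) ∈ Icc 0 T := ⟨le_rfl, ht.1.trans ht.2⟩
  rw [sq_eq_sq₀ (norm_nonneg _) (norm_nonneg _), lpPath, lpPath, dif_pos (hmem t ht),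
    dif_pos (hmem 0 h0), Lp.norm_toLp, Lp.norm_toLp] at hconst
  rw [← h.initial]
  exact (ENNReal.toReal_eq_toReal_iff' (hmem t ht).eLpNorm_ne_top
    (hmem 0 h0).eLpNorm_ne_top).1 hconst

/-! ### Matrix norms, Hölder seminorm and length scale. -/

theorem linftyNorm_le {M : Space → Matrix (Fin 3) (Fin 3) ℝ} {E : ℝ} (hE : 0 ≤ E)
    (h : ∀ x i j, |M x i j| ≤ E) : linftyNorm M ≤ ENNReal.ofReal (3 * E) := by
  unfold linftyNorm
  rw [eLpNorm_exponent_top]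
  refine eLpNormEssSup_le_of_ae_bound (Eventually.of_forall fun x => ?_)
  rw [matrixNorm, Real.norm_of_nonneg (Real.sqrt_nonneg _)]
  refine Real.sqrt_le_iff.2 ⟨by positivity, ?_⟩
  calc ∑ i, ∑ j, M x i j ^ 2 ≤ ∑ _i : Fin 3, ∑ _j : Fin 3, E ^ 2 := by
        refine Finset.sum_le_sum fun i _ => Finset.sum_le_sum fun j _ => ?_
        exact sq_le_sq' (abs_le.1 (h x i j)).1 (abs_le.1 (h x i j)).2
    _ = (3 * E) ^ 2 := by simp; ring

theorem linftyNorm_symGrad_add_antiGrad_le {v : Space → Space} {E : ℝ} (hE : 0 ≤ E)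
    (h : ∀ x i j, |velGrad v x i j| ≤ E) :
    linftyNorm (symGrad v) + linftyNorm (antiGrad v) ≤ ENNReal.ofReal (6 * E) := by
  have h1 : linftyNorm (symGrad v) ≤ ENNReal.ofReal (3 * E) := by
    refine linftyNorm_le hE fun x i j => ?_
    have a := abs_le.1 (h x i j)
    have b := abs_le.1 (h x j i)
    simp only [symGrad, Matrix.smul_apply, Matrix.add_apply, Matrix.transpose_apply, smul_eq_mul]
    rw [abs_le]
    constructor <;> linarith [a.1, a.2, b.1, b.2]
  have h2 : linftyNorm (antiGrad v) ≤ ENNReal.ofReal (3 * E) := by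
    refine linftyNorm_le hE fun x i j => ?_
    have a := abs_le.1 (h x i j)
    have b := abs_le.1 (h x j i)
    simp only [antiGrad, Matrix.smul_apply, Matrix.sub_apply, Matrix.transpose_apply, smul_eq_mul]
    rw [abs_le]
    constructor <;> linarith [a.1, a.2, b.1, b.2]
  refine (add_le_add h1 h2).trans_eq ?_
  rw [← ENNReal.ofReal_add (by positivity) (by positivity)]
  ring_nf

theorem norm_sub_le_holderSeminorm {L δ : ℝ} {w : Space → Space}
    (h : holderSeminorm L δ w ≠ ∞) (x y : Space) (hxy : ‖x - y‖ < L) :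
    ‖w x - w y‖ ≤ (holderSeminorm L δ w).toReal * ‖x - y‖ ^ δ := by
  by_cases hne : x = y
  · subst hne
    simp only [sub_self, norm_zero]
    positivity
  have hpos : 0 < ‖x - y‖ ^ δ := Real.rpow_pos_of_pos (norm_pos_iff.2 (sub_ne_zero.2 hne)) δ
  have h1 : ‖w x - w y‖ₑ / ENNReal.ofReal (‖x - y‖ ^ δ) ≤ holderSeminorm L δ w :=
    le_iSup_of_le x (le_iSup_of_le y (le_iSup_of_le hne (le_iSup_of_le hxy le_rfl)))
  rw [ENNReal.div_le_iff (by simpa using hpos) ENNReal.ofReal_ne_top] at h1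
  have h2 := ENNReal.toReal_mono (ENNReal.mul_ne_top h ENNReal.ofReal_ne_top) h1
  simpa [ENNReal.toReal_mul, ENNReal.toReal_ofReal hpos.le] using h2

/-- A locally Hölder continuous function of exponent larger than `1` is constant. -/
theorem eq_of_local_holder_one_lt {w : Space → Space} {L δ Ω : ℝ} (hL : 0 < L) (hδ : 1 < δ)
    (h : ∀ x y, ‖x - y‖ < L → ‖w x - w y‖ ≤ Ω * ‖x - y‖ ^ δ) (x y : Space) : w x = w y := by
  have hd : ∀ x, HasFDerivAt w (0 : Space →L[ℝ] Space) x := by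
    intro x
    rw [hasFDerivAt_iff_tendsto]
    have hlim : Tendsto (fun z : Space => Ω * ‖z - x‖ ^ (δ - 1)) (𝓝 x) (𝓝 0) := by
      have hc : Continuous fun z : Space => Ω * ‖z - x‖ ^ (δ - 1) :=
        continuous_const.mul (Continuous.rpow_const (by fun_prop) fun _ => Or.inr (by linarith))
      have := hc.tendsto x
      simpa [Real.zero_rpow (by linarith : δ - 1 ≠ 0)] using this
    refine squeeze_zero' (Eventually.of_forall fun z => by positivity) ?_ hlim
    filter_upwards [Metric.ball_mem_nhds x hL] with z hz
    rw [Metric.mem_ball, dist_eq_norm] at hz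
    simp only [zero_apply, sub_zero]
    rcases eq_or_ne z x with rfl | hne
    · simp [Real.zero_rpow (by linarith : δ - 1 ≠ 0)]
    have hpos : 0 < ‖z - x‖ := norm_pos_iff.2 (sub_ne_zero.2 hne)
    rw [Real.rpow_sub hpos, Real.rpow_one, inv_mul_eq_div, ← mul_div_assoc]
    gcongr
    exact h z x hz
  exact is_const_of_fderiv_eq_zero (𝕜 := ℝ) (fun x => (hd x).differentiableAt)
    (fun x => (hd x).fderiv) x y

/-- The defining property of the length scale: it balances vorticity against energy. -/
theorem exists_lengthScale_eq {L δ : ℝ} (hL : 0 < L) (hδ : 0 < δ) {u₀ v : Space → Space}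
    (h0 : eLpNorm u₀ 2 volume ≠ 0) (htop : eLpNorm u₀ 2 volume ≠ ∞)
    (hfin : holderSeminorm L δ (curl v) ≠ ∞) :
    ∃ ρ : ℝ, 0 < ρ ∧ ρ ≤ L ∧ lengthScale L δ u₀ v = ENNReal.ofReal ρ ∧
      (holderSeminorm L δ (curl v)).toReal * ρ ^ δ
        ≤ ρ ^ (-(5 / 2) : ℝ) * (eLpNorm u₀ 2 volume).toReal := by
  set N := (eLpNorm u₀ 2 volume).toReal with hN
  set Ω := (holderSeminorm L δ (curl v)).toReal with hΩ
  have hNpos : 0 < N := ENNReal.toReal_pos h0 htop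
  have hexp : 0 < 2 / (2 * δ + 5) := by positivity
  rcases eq_or_ne (holderSeminorm L δ (curl v)) 0 with hz | hz
  · refine ⟨L, hL, le_rfl, ?_, ?_⟩
    · rw [lengthScale, hz, ENNReal.zero_div, ENNReal.zero_rpow_of_neg (by linarith),
        min_eq_left le_top]
    · rw [hΩ, hz, ENNReal.toReal_zero, zero_mul]
      positivity
  have hΩpos : 0 < Ω := ENNReal.toReal_pos hz hfin
  have hq : 0 < Ω / N := by positivity
  refine ⟨min L ((Ω / N) ^ (-(2 / (2 * δ + 5)))), by positivity, min_le_left _ _, ?_, ?_⟩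
  · rw [lengthScale, ENNReal.ofReal_min, ← ENNReal.ofReal_rpow_of_pos hq,
      ENNReal.ofReal_div_of_pos hNpos, hΩ, hN, ENNReal.ofReal_toReal hfin,
      ENNReal.ofReal_toReal htop]
  · set ρ := min L ((Ω / N) ^ (-(2 / (2 * δ + 5)))) with hρdef
    have hρ : 0 < ρ := by positivity
    have h1 : Ω / N ≤ ρ ^ (-(δ + 5 / 2)) := by
      have := Real.rpow_le_rpow_of_nonpos hρ (min_le_right L ((Ω / N) ^ (-(2 / (2 * δ + 5)))))
        (by linarith : -(δ + 5 / 2) ≤ 0)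
      rw [← Real.rpow_mul hq.le, show -(2 / (2 * δ + 5)) * -(δ + 5 / 2) = 1 by field_simp,
        Real.rpow_one] at this
      exact this
    rw [div_le_iff₀ hNpos] at h1
    calc Ω * ρ ^ δ ≤ ρ ^ (-(δ + 5 / 2)) * N * ρ ^ δ := by gcongr
      _ = (ρ ^ (-(δ + 5 / 2)) * ρ ^ δ) * N := by ring
      _ = _ := by rw [← Real.rpow_add hρ]; ring_nf

end

end EulerFlow

/-! ### The main estimate. -/

theorem mainTheorem3 :
    ∃ C : ℝ → ℝ,
      (∀ δ : ℝ, 0 < δ → 0 < C δ) ∧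
      (∃ A : ℝ, ∀ δ : ℝ, 0 < δ → C δ ≤ A / δ) ∧
      ∀ (δ L s T : ℝ), 0 < δ → 0 < L → 5 / 2 < s → 0 < T →
        ∀ (u : ℝ → EulerFlow.Space → EulerFlow.Space) (p : ℝ → EulerFlow.Space → ℝ)
          (u₀ : EulerFlow.Space → EulerFlow.Space),
          EulerFlow.IsSolution s T u p u₀ →
          ∀ t ∈ Set.Icc 0 T,
            EulerFlow.linftyNorm (EulerFlow.symGrad (u t)) +
                EulerFlow.linftyNorm (EulerFlow.antiGrad (u t)) ≤
              ENNReal.ofReal (C δ) * MeasureTheory.eLpNorm u₀ 2 MeasureTheory.volume *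
                EulerFlow.lengthScale L δ u₀ (u t) ^ (-(5 / 2) : ℝ) := by
  obtain ⟨K, hK, hest⟩ := EulerFlow.exists_velGrad_estimate
  -- `12 = 6 · 2`: a factor `3` from the nine entries of each of the two matrices, and `2` from the
  -- vorticity and energy terms.
  refine ⟨fun δ => 12 * K / δ, fun δ hδ => by positivity, ⟨12 * K, fun δ _ => le_rfl⟩, ?_⟩
  intro δ L s T hδ hL hs _ u p u₀ h t ht
  have hv := h.velocity_space t ht
  have hv2 : MemLp (u t) 2 := EulerFlow.memLp_of_sobolevNorm_lt_top (h.mem_class t ht).1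
  have hdiv := h.incompressible t ht
  have henergy := EulerFlow.eLpNorm_eq_initial hs h ht
  have htop : eLpNorm u₀ 2 volume ≠ ∞ := henergy ▸ hv2.eLpNorm_ne_top
  have hvanish : (∀ x i j, EulerFlow.velGrad (u t) x i j = 0) →
      EulerFlow.linftyNorm (EulerFlow.symGrad (u t)) +
        EulerFlow.linftyNorm (EulerFlow.antiGrad (u t)) = 0 := fun hz => by
    simpa using EulerFlow.linftyNorm_symGrad_add_antiGrad_le le_rfl
      fun x i j => (abs_eq_zero.2 (hz x i j)).le
  by_cases h0 : eLpNorm u₀ 2 volume = 0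
  · have hut : u t = 0 := by
      rw [← henergy, eLpNorm_eq_zero_iff hv2.1 (by norm_num)] at h0
      exact (Continuous.ae_eq_iff_eq volume hv.continuous continuous_const).1 h0
    rw [hvanish fun x i j => by simp [hut, EulerFlow.velGrad]]
    exact zero_le
  by_cases hfin : EulerFlow.holderSeminorm L δ (EulerFlow.curl (u t)) = ∞
  · have hl : EulerFlow.lengthScale L δ u₀ (u t) = 0 := by
      have : 0 < 2 / (2 * δ + 5) := by positivity
      rw [EulerFlow.lengthScale, hfin, ENNReal.top_div_of_ne_top htop,
        ENNReal.top_rpow_of_neg (by linarith)]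
      exact min_eq_right zero_le
    -- The right side is infinite only because the prefactor is nonzero, as `0 * ∞ = 0`.
    have hC : ENNReal.ofReal (12 * K / δ) * eLpNorm u₀ 2 volume ≠ 0 :=
      mul_ne_zero (by simpa using by positivity) h0
    rw [hl, ENNReal.zero_rpow_of_neg (by norm_num), ENNReal.mul_top hC]
    exact le_top
  have hhol := EulerFlow.norm_sub_le_holderSeminorm hfin
  -- The energy term carries no `1/δ`; for `δ ≤ 1` it is absorbed through `1 ≤ 1/δ`. For `δ > 1` the
  -- vorticity is constant, so the static estimate holds with `Ω = 0` at every scale, and `ρ → ∞`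
  -- gives `Du = 0`.
  rcases lt_or_ge 1 δ with hδ1 | hδ1
  · have hconst := EulerFlow.eq_of_local_holder_one_lt hL hδ1 hhol
    rw [hvanish fun x i j => ?_]
    · exact zero_le
    have hb : ∀ ρ : ℝ, 0 < ρ → |EulerFlow.velGrad (u t) x i j|
        ≤ K * (0 * ρ ^ δ / δ + ρ ^ (-(5 / 2) : ℝ) * (eLpNorm (u t) 2 volume).toReal) :=
      fun ρ hρ => hest (u t) hv hv2 hdiv δ ρ 0 hδ hρ le_rfl
        (fun x y _ => by rw [hconst x y]; simp) x i j
    have hlim : Tendsto (fun ρ : ℝ => K * (0 * ρ ^ δ / δ + ρ ^ (-(5 / 2) : ℝ) *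
        (eLpNorm (u t) 2 volume).toReal)) atTop (𝓝 0) := by
      have := ((tendsto_rpow_neg_atTop (by norm_num : (0 : ℝ) < 5 / 2)).mul_const
        (eLpNorm (u t) 2 volume).toReal).const_mul K
      simpa using this
    refine abs_nonpos_iff.1 (ge_of_tendsto hlim ?_)
    filter_upwards [eventually_gt_atTop 0] with ρ hρ using hb ρ hρ
  · obtain ⟨ρ, hρ, hρL, hl, hbal⟩ := EulerFlow.exists_lengthScale_eq hL hδ h0 htop hfin
    set Ω := (EulerFlow.holderSeminorm L δ (EulerFlow.curl (u t))).toReal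
    set N := (eLpNorm u₀ 2 volume).toReal with hN
    have hb : ∀ x i j, |EulerFlow.velGrad (u t) x i j| ≤ 2 * K / δ * (ρ ^ (-(5 / 2) : ℝ) * N) := by
      intro x i j
      have h1 := hest (u t) hv hv2 hdiv δ ρ Ω hδ hρ ENNReal.toReal_nonneg
        (fun x y hxy => hhol x y (hxy.trans_le hρL)) x i j
      rw [henergy, ← hN] at h1
      refine h1.trans ?_
      have hP : 0 ≤ ρ ^ (-(5 / 2) : ℝ) * N := by positivity
      have e1 : Ω * ρ ^ δ / δ ≤ ρ ^ (-(5 / 2) : ℝ) * N / δ := by gcongr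
      have e2 : ρ ^ (-(5 / 2) : ℝ) * N ≤ ρ ^ (-(5 / 2) : ℝ) * N / δ := le_div_self hP hδ hδ1
      calc _ ≤ K * (ρ ^ (-(5 / 2) : ℝ) * N / δ + ρ ^ (-(5 / 2) : ℝ) * N / δ) := by gcongr
        _ = _ := by ring
    refine (EulerFlow.linftyNorm_symGrad_add_antiGrad_le (by positivity) hb).trans_eq ?_
    rw [hl, ENNReal.ofReal_rpow_of_pos hρ, ← ENNReal.ofReal_toReal htop, ← hN,
      ← ENNReal.ofReal_mul (by positivity), ← ENNReal.ofReal_mul (by positivity)]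
    congr 1
    ring
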